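/- **Setting.** Let $d\ge 1$ and let $\mathscr T_1,\dots,\mathscr T_d$ be leafless, locally finite rooted directed trees, $\mathscr T_j=(V_j,\mathcal E_j)$, with root $\mathsf{root}_j$, such that the depths of the branching vertices (those with at least two children) of each $\mathscr T_j$ are bounded (finite joint branching index). Let $V=V_1\times\cdots\times V_d$ be the vertex set of their directed Cartesian product $\mathscr T$ and $\mathsf{root}=(\mathsf{root}_1,\dots,\mathsf{root}_d)$. For $v\in V$ let $\mathsf d_v=(\mathsf d_{v_1},\dots,\mathsf d_{v_d})\in\mathbb N^d$ be its depth and $|\mathsf d_v|=\sum_j\mathsf d_{v_j}$; $\mathsf{Chi}_j(v)$ is the set of vertices obtained from $v$ by replacing $v_j$ by one of its children, and $\mathsf{par}_j(v)$ (if $v_j\ne\mathsf{root}_j$) is obtained by replacing $v_j$ by its parent; $\mathsf{sib}(v_j)$ is the set of all children of the parent of $v_j$ (including $v_j$). Let $a\ge d$ be an integer and $\mathfrak c_a(t)=\frac{t+d}{t+a}$, $t\in\mathbb N$. The Drury–Arveson-type multishift $S=(S_1,\dots,S_d)$ is the commuting $d$-tuple of bounded operators on $\ell^2(V)$ given by $(S_jf)(v)=\lambda_j(v)f(\mathsf{par}_j(v))$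 if $v_j\ne\mathsf{root}_j$ and $(S_jf)(v)=0$ otherwise, where $$\lambda_j(w)=\sqrt{\frac{\mathfrak c_a(|\mathsf d_v|)}{\mathrm{card}(\mathsf{Chi}_j(v))}}\sqrt{\frac{\mathsf d_{v_j}+1}{|\mathsf d_v|+d}},\qquad w\in\mathsf{Chi}_j(v).$$ Let $E=\bigcap_j\ker S_j^*$. The analytic model $\mathscr H_{\mathfrak c_a}(\mathscr T)$ of $S$ is the space of $E$-valued functions $\sum_{\alpha\in\mathbb N^d}f_\alpha z^\alpha$ on the open unit ball of $\mathbb C^d$ with $f_\alpha\in E$ and $\sum_\alpha\|S^\alpha f_\alpha\|^2<\infty$, with inner product $\langle\sum f_\alpha z^\alpha,\sum g_\alpha z^\alpha\rangle=\sum_\alpha\langle S^\alpha f_\alpha,S^\alpha g_\alpha\rangle$. For $F\subseteq\{1,\dots,d\}$ let $\Phi_F$ be the set of $v\in V$ with $v_j\neq\mathsf{root}_j$ exactly for $j\in F$. For $u\in\Phi_F$ let $\mathsf{sib}_F(u)$ be the set of $w\in V$ with $w_j\in\mathsf{sib}(u_j)$ for $j\in F$ and $w_j=u_j$ for $j\notin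 F$. Let $\Omega_F\subseteq\Phi_F$ contain exactly one element of each of the classes $\mathsf{sib}_F(u)$, $u\in\Phi_F$. For $u\in\Omega_F$ let $\mathcal L_{u,F}$ be the space of $f\in\ell^2(V)$ that vanish off $\mathsf{sib}_F(u)$ and satisfy $\sum_{w}f(w)\lambda_j(w)=0$ for every $j\in F$ and $v\in\mathsf{sib}_F(u)$, the sum being over the $w\in \mathsf{sib}_F(u)$ with $w_i=v_i$ for all $i\ne j$. (Then $E=\bigoplus_F\bigoplus_{u\in\Omega_F}\mathcal L_{u,F}$.) A *representing measure* of $\mathscr H_{\mathfrak c_a}(\mathscr T)$, supported on $[0,b]\times\partial\mathbb B^d$ ($\partial\mathbb B^d$ the unit sphere of $\mathbb C^d$), is a $B(E)$-valued measure $M$ on $[0,b]\times\partial\mathbb B^d$ with scalar measures $\rho_u$ on $[0,b]$ and $\nu_u$ on $\partial\mathbb B^d$ ($u\in\Omega_F$, $F\subseteq\{1,\dots,d\}$) such that 1. $\|z^\alpha f\|^2_{\mathscr H_{\mathfrak c_a}(\mathscr T)}=\int s^{|\alpha|}|z^\alpha|^2\,\langle dM(s,z)f,f\rangle$ for all $f\in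 E$, $\alpha\in\mathbb N^d$; 2. $M(A)\big(\sum_{F,u}g_{u,F}\big)=\sum_{F,u}(\rho_u\times\nu_u)(A)\,g_{u,F}$ for all finite sums with $g_{u,F}\in\mathcal L_{u,F}$ and all Borel sets $A$; 3. $\rho_{\mathsf{root}}$ and $\nu_{\mathsf{root}}$ are probability measures. **Corollary 2.10.** If $a$ is an integer with $a\ge d$, then $\mathscr H_{\mathfrak c_a}(\mathscr T)$ admits a representing measure supported on $[0,1]\times\partial\mathbb B^d$ for which the finite positive measures $\rho_u$ and $\nu_u$, $u\in\Omega_F$, $F\subseteq\{1,\dots,d\}$, are given by $$d\rho_u(s)=\begin{cases}w_{|\mathsf d_u|}(s)\,dm(s)&\text{if }a>d,\\ d\delta_1(s)&\text{if }a=d,\end{cases}\qquad d\nu_u(z)=\frac{|z^{\mathsf d_u}|^2}{\|z^{\mathsf d_u}\|^2_{L^2(\partial\mathbb B^d,\sigma)}}\,d\sigma(z),$$ where $m$ is Lebesgue measure on $[0,1]$, $\delta_1$ is the unit point mass at $1$, $\sigma$ is the normalized surface area measure on $\partial\mathbb B^d$, and, for $a>d$, the function $$w_l(s)=(l+d)(l+d+1)\cdots(l+a-1)\sum_{i=d}^{a-1}\frac{s^{i+l-1}}{\prod_{d\le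 j\le a-1,\ j\ne i}(j-i)},\qquad s\in[0,1],\ l\in\mathbb N,$$ is nonnegative on $[0,1]$. -/

import Mathlib

open Set MeasureTheory
open scoped ENNReal lp InnerProductSpace

noncomputable section

/-- A rooted directed tree: a directed graph with a distinguished vertex `root` that has no parent,
in which every vertex has at most one parent and is reachable from the root by a directed path.
(There are then no circuits, and every vertex other than the root has exactly one parent.) -/
structure RootedDirectedTree (V : Type*) extends Digraph V where
  /-- the root -/
  root : V
  not_adj_root : ∀ v, ¬ Adj v root
  parent_unique : ∀ {u v w}, Adj u w → Adj v w → u = v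
  reachable : ∀ v, Relation.ReflTransGen Adj root v

namespace RootedDirectedTree

variable {V : Type*} (T : RootedDirectedTree V)

/-- The set `Chi(v)` of children of `v`. -/
def children (v : V) : Set V := {w | T.Adj v w}

open Classical in
/-- The parent of a vertex `w ≠ root` (by convention the root itself for `w = root`). -/
def parent (w : V) : V := if h : ∃ v, T.Adj v w then h.choose else T.root

/-- The set `sib(w) = Chi(par(w))` of siblings of `w ≠ root`, which contains `w`. -/
def sib (w : V) : Set V := T.children (T.parent w)

/-- `T.gen n` is `Chi^n(root)`, the `n`-th generation. -/
def gen : ℕ → Set V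
  | 0 => {T.root}
  | n + 1 => {w | ∃ v ∈ gen n, T.Adj v w}

/-- The depth of `v`: the (unique) `n` with `v ∈ Chi^n(root)`. -/
def depth (v : V) : ℕ := sInf {n | v ∈ T.gen n}

/-- Every vertex has finitely many children. -/
def LocallyFinite : Prop := ∀ v, (T.children v).Finite

/-- Every vertex has at least one child. -/
def Leafless : Prop := ∀ v, (T.children v).Nonempty

/-- The set of branching vertices, those with at least two children. -/
def branchingVertices : Set V := {v | 2 ≤ (T.children v).encard}

/-- The branching index: `1 + sup` of the depths of the branching vertices, and `0` if there is
no branching vertex; the value is `⊤` if these depths are unbounded. -/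
def branchingIndex : ℕ∞ := ⨆ w ∈ T.branchingVertices, (1 + (T.depth w : ℕ∞))

lemma children_of_parent {w : V} (hw : w ≠ T.root) : w ∈ T.children (T.parent w) := by
  have h : ∃ v, T.Adj v w := by
    rcases (Relation.ReflTransGen.cases_tail (T.reachable w)) with h | ⟨v, -, hv⟩
    · exact absurd h hw
    · exact ⟨v, hv⟩
  simp only [children, parent, dif_pos h, mem_ofPred_eq]
  exact h.choose_spec

end RootedDirectedTree

/-- Sequences `c : ℕ → (0, ∞)` with `inf c > 0` and `sup c < ∞`. -/
structure AdmissibleSeq where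
  /-- the sequence -/
  toFun : ℕ → ℝ
  inf_pos : ∃ ε > 0, ∀ t, ε ≤ toFun t
  bdd : ∃ C, ∀ t, toFun t ≤ C

/-- The sequence `c_a(t) = (t + d) / (t + a)`. -/
def druryArvesonSeq (d : ℕ) (a : ℝ) (hd : 0 < d) (ha : 0 < a) : AdmissibleSeq where
  toFun t := (t + d) / (t + a)
  inf_pos := by
    have hd' : (0 : ℝ) < d := by exact_mod_cast hd
    refine ⟨min 1 (d / a), by positivity, fun t => ?_⟩
    have ht : (0 : ℝ) ≤ t := t.cast_nonneg
    rw [le_div_iff₀ (by positivity)]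
    have h1 := mul_le_mul_of_nonneg_right (min_le_left 1 ((d : ℝ) / a)) ht
    have h2 := mul_le_mul_of_nonneg_right (min_le_right 1 ((d : ℝ) / a)) ha.le
    rw [div_mul_cancel₀ _ ha.ne'] at h2
    linarith
  bdd := by
    refine ⟨max 1 (d / a), fun t => ?_⟩
    have ht : (0 : ℝ) ≤ t := t.cast_nonneg
    rw [div_le_iff₀ (by positivity)]
    have h1 := mul_le_mul_of_nonneg_right (le_max_left 1 ((d : ℝ) / a)) ht
    have h2 := mul_le_mul_of_nonneg_right (le_max_right 1 ((d : ℝ) / a)) ha.le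
    rw [div_mul_cancel₀ _ ha.ne'] at h2
    linarith

namespace TreeProduct

variable {d : ℕ} {V : Fin d → Type*} (T : ∀ j, RootedDirectedTree (V j))

/-- The root of the directed Cartesian product, whose vertex set is `V 0 × ⋯ × V (d - 1)`. -/
def root : ∀ j, V j := fun j => (T j).root

/-- The depth multi-index `d_v` of a vertex `v` of the product. -/
def depth (v : ∀ j, V j) : Fin d → ℕ := fun j => (T j).depth (v j)

/-- The total depth `|d_v|`. -/
def absDepth (v : ∀ j, V j) : ℕ := ∑ j, depth T v j

/-- `par_j(v)`: the `j`-th coordinate is replaced by its parent. -/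
def par (j : Fin d) (v : ∀ j, V j) : ∀ j, V j := Function.update v j ((T j).parent (v j))

/-- The weight `λ_j(w)`, for `w ∈ Chi_j(v)`, that is, for `v = par_j(w)` and `w_j ≠ root_j`. (The
value for `w_j = root_j` is never used.) Here `card Chi_j(v) = card Chi(v_j)`. -/
def weight (c : AdmissibleSeq) (j : Fin d) (w : ∀ j, V j) : ℝ :=
  √(c.toFun (absDepth T (par T j w)) / (((T j).children (par T j w j)).ncard : ℝ)) *
    √((((T j).depth (par T j w j) : ℝ) + 1) / ((absDepth T (par T j w) : ℝ) + d))

open Classical in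
/-- The map `Λ_j` on all complex functions on the vertex set. -/
def shiftFun (c : AdmissibleSeq) (j : Fin d) (f : (∀ j, V j) → ℂ) (v : ∀ j, V j) : ℂ :=
  if v j = (T j).root then 0 else (weight T c j v : ℂ) * f (par T j v)

lemma weight_sq_le (c : AdmissibleSeq) {C : ℝ} (hC : ∀ t, c.toFun t ≤ C) (j : Fin d)
    (v : ∀ j, V j) :
    weight T c j v ^ 2 ≤ C / (((T j).children (par T j v j)).ncard : ℝ) := by
  obtain ⟨ε, hε, hε'⟩ := c.inf_pos
  have hc : 0 ≤ c.toFun (absDepth T (par T j v)) := hε.le.trans (hε' _)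
  have hd : (1 : ℝ) ≤ d := by exact_mod_cast (Nat.succ_le_of_lt (Fin.pos j))
  have hle : ((T j).depth (par T j v j) : ℝ) ≤ absDepth T (par T j v) := by
    exact_mod_cast Finset.single_le_sum (f := depth T (par T j v)) (fun _ _ => Nat.zero_le _)
      (Finset.mem_univ j)
  rw [weight, mul_pow, Real.sq_sqrt (by positivity), Real.sq_sqrt (by positivity)]
  have h1 : (((T j).depth (par T j v j) : ℝ) + 1) / ((absDepth T (par T j v) : ℝ) + d) ≤ 1 := by
    rw [div_le_one (by positivity)]
    linarith
  calc _ ≤ c.toFun (absDepth T (par T j v)) / (((T j).children (par T j v j)).ncard : ℝ) * 1 := by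
        gcongr
    _ ≤ _ := by
        rw [mul_one]
        gcongr
        exact hC _

lemma sum_shiftFun_le (c : AdmissibleSeq) {C : ℝ} (hC : ∀ t, c.toFun t ≤ C) (j : Fin d)
    (f : (∀ j, V j) → ℂ) (hf : Summable fun v => ‖f v‖ ^ 2) (s : Finset (∀ j, V j)) :
    ∑ v ∈ s, ‖shiftFun T c j f v‖ ^ 2 ≤ C * ∑' v, ‖f v‖ ^ 2 := by
  classical
  obtain ⟨ε, hε, hε'⟩ := c.inf_pos
  have hC0 : 0 ≤ C := hε.le.trans ((hε' 0).trans (hC 0))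
  have key : ∀ u ∈ s.image (par T j),
      ∑ v ∈ s with par T j v = u, ‖shiftFun T c j f v‖ ^ 2 ≤ C * ‖f u‖ ^ 2 := by
    intro u _
    set N : ℕ := ((T j).children (u j)).ncard with hN
    have hterm : ∀ v ∈ s.filter (fun v => par T j v = u), ‖shiftFun T c j f v‖ ^ 2 ≤
        if v j = (T j).root then 0 else C / N * ‖f u‖ ^ 2 := by
      intro v hv
      obtain ⟨-, rfl⟩ := Finset.mem_filter.1 hv
      unfold shiftFun
      split_ifs with h
      · simp
      · rw [norm_mul, mul_pow, Complex.norm_real, Real.norm_eq_abs, sq_abs]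
        gcongr
        exact weight_sq_le T c hC j v
    refine (Finset.sum_le_sum hterm).trans ?_
    rw [Finset.sum_ite, Finset.sum_const_zero, zero_add, Finset.sum_const, nsmul_eq_mul,
      Finset.filter_filter]
    set A := s.filter (fun v => par T j v = u ∧ ¬ v j = (T j).root) with hA
    by_cases hfin : ((T j).children (u j)).Finite
    · have hcard : A.card ≤ N := by
        rw [hN, Set.ncard_eq_toFinset_card _ hfin]
        refine Finset.card_le_card_of_injOn (fun v => v j) ?_ ?_
        · intro v hv
          obtain ⟨-, hu, hr⟩ := Finset.mem_filter.1 hv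
          have hu' : u j = (T j).parent (v j) := by rw [← hu]; simp [par]
          simpa [hu'] using (T j).children_of_parent hr
        · intro v hv w hw hvw
          obtain ⟨-, hu, -⟩ := Finset.mem_filter.1 hv
          obtain ⟨-, hu', -⟩ := Finset.mem_filter.1 hw
          funext i
          by_cases hi : i = j
          · subst hi; exact hvw
          · have := congrFun (hu.trans hu'.symm) i
            simpa [par, hi] using this
      have hcard' : (A.card : ℝ) ≤ N := by exact_mod_cast hcard
      rw [← mul_assoc]
      refine mul_le_mul_of_nonneg_right ?_ (by positivity)
      rcases Nat.eq_zero_or_pos N with h0 | h0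
      · simp [h0, hC0]
      · have : (0 : ℝ) < N := by exact_mod_cast h0
        calc (A.card : ℝ) * (C / N) ≤ N * (C / N) := by gcongr
          _ = C := by field_simp
    · have h0 : N = 0 := Set.Infinite.ncard hfin
      simp only [h0, Nat.cast_zero, div_zero, zero_mul, mul_zero]
      positivity
  rw [← Finset.sum_fiberwise_of_maps_to (g := par T j)
    (fun v hv => Finset.mem_image_of_mem (par T j) hv)]
  refine (Finset.sum_le_sum key).trans ?_
  rw [← Finset.mul_sum]
  gcongr
  exact hf.sum_le_tsum _ (fun _ _ => by positivity)

lemma summable_sq (f : ℓ²(∀ j, V j, ℂ)) : Summable fun v => ‖f v‖ ^ 2 := by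
  have := lp.memℓp f
  simpa using this.summable (by norm_num)

lemma shiftFun_memℓp (c : AdmissibleSeq) (j : Fin d) (f : ℓ²(∀ j, V j, ℂ)) :
    Memℓp (shiftFun T c j f) 2 := by
  obtain ⟨C, hC⟩ := c.bdd
  refine memℓp_gen ?_
  simpa using summable_of_sum_le (fun _ => by positivity)
    (sum_shiftFun_le T c hC j f (summable_sq f))

/-- The operator `S_j` of the multishift with weights `weight T c`, a bounded operator on the
space of square summable functions on the vertex set. -/
def shift (c : AdmissibleSeq) (j : Fin d) : ℓ²(∀ j, V j, ℂ) →L[ℂ] ℓ²(∀ j, V j, ℂ) :=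
  LinearMap.mkContinuousOfExistsBound
    { toFun := fun f => ⟨shiftFun T c j f, shiftFun_memℓp T c j f⟩
      map_add' := fun f g => by
        ext v
        change shiftFun T c j (fun w => f w + g w) v = shiftFun T c j f v + shiftFun T c j g v
        by_cases h : v j = (T j).root <;> simp [shiftFun, h, mul_add]
      map_smul' := fun a f => by
        ext v
        by_cases h : v j = (T j).root <;> simp [shiftFun, h, mul_left_comm] }
    (by
      obtain ⟨C, hC⟩ := c.bdd
      have hC0 : 0 ≤ C := by
        obtain ⟨ε, hε, hε'⟩ := c.inf_pos
        exact hε.le.trans ((hε' 0).trans (hC 0))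
      refine ⟨√C, fun f => ?_⟩
      have hp : 0 < (2 : ℝ≥0∞).toReal := by norm_num
      refine lp.norm_le_of_forall_sum_le hp (by positivity) fun s => ?_
      have h1 := sum_shiftFun_le T c hC j f (summable_sq f) s
      have h2 := lp.norm_rpow_eq_tsum hp f
      simp only [ENNReal.toReal_ofNat, Real.rpow_ofNat] at h2 ⊢
      rw [mul_pow, Real.sq_sqrt hC0, h2]
      exact h1)

/-- `S^α = S_1^{α_1} ⋯ S_d^{α_d}`. -/
def shiftPow (c : AdmissibleSeq) (α : Fin d → ℕ) : ℓ²(∀ j, V j, ℂ) →L[ℂ] ℓ²(∀ j, V j, ℂ) :=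
  (List.ofFn fun j => shift T c j ^ α j).prod

/-- The joint kernel `E` of the adjoints `S_1^*, …, S_d^*`. -/
def jointKernel (c : AdmissibleSeq) : Submodule ℂ (ℓ²(∀ j, V j, ℂ)) :=
  ⨅ j, (ContinuousLinearMap.adjoint (shift T c j)).ker

/-! ### The decomposition of the joint kernel -/

/-- `Φ_F`: the vertices `v` with `v_j ≠ root_j` exactly for `j ∈ F`. -/
def Phi (F : Finset (Fin d)) : Set (∀ j, V j) := {v | ∀ j, j ∈ F ↔ v j ≠ (T j).root}

/-- `sib_F(u)`: the vertices `w` with `w_j ∈ sib(u_j)` for `j ∈ F` and `w_j = u_j` for `j ∉ F`. -/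
def sib (F : Finset (Fin d)) (u : ∀ j, V j) : Set (∀ j, V j) :=
  {w | ∀ j, (j ∈ F → w j ∈ (T j).sib (u j)) ∧ (j ∉ F → w j = u j)}

/-- `v_G`: the coordinates outside `G` are replaced by the roots. -/
def trunc (G : Finset (Fin d)) (v : ∀ j, V j) : ∀ j, V j :=
  fun j => if j ∈ G then v j else (T j).root

/-- `Ω` picks exactly one vertex from each of the classes `sib_F(u)`, `u ∈ Φ_F`, for every `F`. -/
def IsIndexing (Ω : Finset (Fin d) → Set (∀ j, V j)) : Prop :=
  ∀ F, Ω F ⊆ Phi T F ∧ ∀ v ∈ Phi T F, ∃! u, u ∈ Ω F ∧ u ∈ sib T F v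

/-- `L_{u,F}`: the `f ∈ ℓ²` that vanish off `sib_F(u)` and satisfy
`∑_{w ∈ sib_j(v_G | u_j)} f(w) λ_j(w) = 0` for all `j ∈ F`, `G = F \ {j}` and `v ∈ sib_F(u)`. -/
def cokerPiece (c : AdmissibleSeq) (u : ∀ j, V j) (F : Finset (Fin d)) :
    Set (ℓ²(∀ j, V j, ℂ)) :=
  {f | (∀ w, w ∉ sib T F u → f w = 0) ∧
    ∀ j ∈ F, ∀ v ∈ sib T F u,
      ∑ᶠ w ∈ sib T {j} (Function.update (trunc T (F.erase j) v) j (u j)),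
        f w * (weight T c j w : ℂ) = 0}

/-! ### The analytic model -/

/-- The monomial `z^α`. -/
def monom (z : EuclideanSpace ℂ (Fin d)) (α : Fin d → ℕ) : ℂ := ∏ j, z j ^ α j

/-- `f` is a family of power series coefficients of an element `G` of the model space. -/
def IsCoeff (c : AdmissibleSeq) {r : ℝ}
    (G : Metric.ball (0 : EuclideanSpace ℂ (Fin d)) r → jointKernel T c)
    (f : (Fin d → ℕ) → jointKernel T c) : Prop :=
  (Summable fun α => ‖shiftPow T c α (f α)‖ ^ 2) ∧
    ∀ z, HasSum (fun α => monom z.1 α • f α) (G z)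

/-- The analytic model `H_c(T)` on the ball of radius `r`: the space of the `E`-valued functions
`∑_α f_α z^α` on that ball with `f_α ∈ E` and `∑_α ‖S^α f_α‖² < ∞`. -/
def modelSpace (c : AdmissibleSeq) (r : ℝ) :
    Submodule ℂ (Metric.ball (0 : EuclideanSpace ℂ (Fin d)) r → jointKernel T c) where
  carrier := {G | ∃ f, IsCoeff T c G f}
  zero_mem' := ⟨0, by simp [summable_zero], fun z => by simp⟩
  add_mem' := by
    rintro G H ⟨f, hf, hf'⟩ ⟨g, hg, hg'⟩
    refine ⟨f + g, ?_, fun z => by simpa using (hf' z).add (hg' z)⟩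
    refine Summable.of_nonneg_of_le (fun _ => by positivity) (fun α => ?_)
      ((hf.add hg).mul_left 2)
    simp only [Pi.add_apply, Submodule.coe_add, map_add]
    have h1 := norm_add_le (shiftPow T c α (f α)) (shiftPow T c α (g α))
    have h2 := norm_nonneg (shiftPow T c α (f α) + shiftPow T c α (g α))
    nlinarith [sq_nonneg (‖shiftPow T c α (f α)‖ - ‖shiftPow T c α (g α)‖)]
  smul_mem' := by
    rintro a G ⟨f, hf, hf'⟩
    refine ⟨a • f, ?_, fun z => ?_⟩
    · simpa [norm_smul, mul_pow] using hf.mul_left (‖a‖ ^ 2)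
    · simpa [smul_comm a] using (hf' z).const_smul a

/-- The coefficients `f_α` of an element `∑_α f_α z^α` of the model space (for `r > 0` they are
determined by the function). -/
def coeff {c : AdmissibleSeq} {r : ℝ} (G : modelSpace T c r) : (Fin d → ℕ) → jointKernel T c :=
  G.2.choose

/-- The inner product `⟨F, G⟩ = ∑_α ⟨S^α f_α, S^α g_α⟩` of the model space (with Mathlib's
convention: conjugate linear in the first argument). -/
def modelInner {c : AdmissibleSeq} {r : ℝ} (F G : modelSpace T c r) : ℂ :=
  ∑' α, ⟪shiftPow T c α (coeff T F α : ℓ²(∀ j, V j, ℂ)), shiftPow T c α (coeff T G α)⟫_ℂ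

/-- The norm of the model space. -/
def modelNorm {c : AdmissibleSeq} {r : ℝ} (F : modelSpace T c r) : ℝ :=
  √(RCLike.re (modelInner T F F))

/-- The function `z ↦ z^α f`, for `f ∈ E`, as an element of the model space. -/
def monomial (c : AdmissibleSeq) (r : ℝ) (α : Fin d → ℕ) (f : jointKernel T c) :
    modelSpace T c r :=
  ⟨fun z => monom z.1 α • f, by
    classical
    refine ⟨Pi.single α f, ?_, fun z => ?_⟩
    · refine summable_of_ne_finset_zero (s := {α}) fun β hβ => ?_
      rw [Finset.mem_singleton] at hβ
      simp [Pi.single_eq_of_ne hβ]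
    · have := hasSum_single (f := fun β => monom z.1 β • (Pi.single α f : _ → jointKernel T c) β) α
        (fun β hβ => by simp [Pi.single_eq_of_ne hβ])
      simpa using this⟩

/-! ### Representing measures -/

/-- The unit sphere of `ℂ^d`. -/
abbrev Sphere (d : ℕ) : Type := Metric.sphere (0 : EuclideanSpace ℂ (Fin d)) 1

/-- The normalized surface area measure on the unit sphere of `ℂ^d`. -/
def sphereMeasure (d : ℕ) : Measure (Sphere d) :=
  let μ : Measure (Sphere d) := (volume : Measure (EuclideanSpace ℂ (Fin d))).toSphere
  (μ univ)⁻¹ • μ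

/-- `M` is a `B(E)`-valued product measure `(ρ_u × ν_u)`, `u ∈ Ω_F`, supported on `[0, b] × ∂𝔹`,
that represents the norms `‖z^α f‖`, `f ∈ E`, in the analytic model on the ball of radius `r`. -/
structure IsRepresentingMeasure (c : AdmissibleSeq) (r b : ℝ)
    (Ω : Finset (Fin d) → Set (∀ j, V j))
    (M : VectorMeasure (ℝ × Sphere d) (jointKernel T c →L[ℂ] jointKernel T c))
    (ρ : (∀ j, V j) → Measure ℝ) (ν : (∀ j, V j) → Measure (Sphere d)) : Prop where
  finite : ∀ F, ∀ u ∈ Ω F, IsFiniteMeasure (ρ u) ∧ IsFiniteMeasure (ν u)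
  supported_scalar : ∀ F, ∀ u ∈ Ω F, ρ u (Icc 0 b)ᶜ = 0
  supported : ∀ A, MeasurableSet A → Disjoint A (Icc 0 b ×ˢ univ) → M A = 0
  /-- For each `f ∈ E` the scalar set function `A ↦ ⟨M(A) f, f⟩` is a finite positive measure `μ`,
  and `‖z^α f‖²` is the integral of `s^|α| |z^α|²` against it. -/
  integral_representation : ∀ f : jointKernel T c, ∃ μ : Measure (ℝ × Sphere d),
    IsFiniteMeasure μ ∧
    (∀ A, MeasurableSet A → ⟪f, M A f⟫_ℂ = (μ.real A : ℂ)) ∧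
    ∀ α : Fin d → ℕ,
      Integrable (fun p => p.1 ^ (∑ j, α j) * ‖monom p.2.1 α‖ ^ 2) μ ∧
      modelNorm T (monomial T c r α f) ^ 2 =
        ∫ p, p.1 ^ (∑ j, α j) * ‖monom p.2.1 α‖ ^ 2 ∂μ
  /-- `M(A)` maps `∑ g_{u,F}` to `∑ (ρ_u × ν_u)(A) g_{u,F}`. -/
  diagonal : ∀ A, MeasurableSet A → ∀ I : Finset (Finset (Fin d) × (∀ j, V j)),
    (∀ p ∈ I, p.2 ∈ Ω p.1) → ∀ g : Finset (Fin d) × (∀ j, V j) → jointKernel T c,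
    (∀ p ∈ I, (g p : ℓ²(∀ j, V j, ℂ)) ∈ cokerPiece T c p.2 p.1) →
    M A (∑ p ∈ I, g p) = ∑ p ∈ I, ((((ρ p.2).prod (ν p.2)).real A : ℝ) : ℂ) • g p
  normalized : IsProbabilityMeasure (ρ (root T)) ∧ IsProbabilityMeasure (ν (root T))

/-- The weight function
`w_l(s) = (l + d) ⋯ (l + a - 1) ∑_{i = d}^{a - 1} s^{i + l - 1} / ∏_{d ≤ j ≤ a - 1, j ≠ i} (j - i)`. -/
def radialWeight (d a l : ℕ) (s : ℝ) : ℝ :=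
  (∏ k ∈ Finset.Ico d a, ((l : ℝ) + k)) *
    ∑ i ∈ Finset.Ico d a, s ^ (i + l - 1) / ∏ j ∈ (Finset.Ico d a).erase i, ((j : ℝ) - i)

end TreeProduct

end

/-! Everything depends on depths only. The weight `λ_j` is constant on the children of `u` in
direction `j`, and its square carries the reciprocal of their number. Hence `S_j^* S_j` is
multiplication by a function of `d_u`, and `S_j` sends functions living at depth `δ` to depth `δ +
e_j`, multiplying the squared norm by `(δ_j + 1) / (|δ| + a)`. With `G(β) = β! / (|β| + a - 1)!`
this factor is `G(δ + e_j) / G(δ)`, so `S^α` multiplies it by `G(δ + α) / G(δ)`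
(`raisesDepth_shiftPow`).

The kernel `E` is invariant under the projections `P_δ` onto depth `δ`, and beyond the last
branching vertices a vertex is an only child, so only finitely many `δ` occur in `E`
(`exists_depth_bound`). Since different depths stay orthogonal, `‖z^α f‖² = ∑_δ ‖P_δ f‖² G(δ + α) /
G(δ)` (`norm_shiftPow_sq`).

It remains to see `G(δ + α) / G(δ)` as a moment of a product measure. On the sphere, `∫ |z^β|² dσ =
(d - 1)! β! / (|β| + d - 1)!`. The radial weight is a normalized `s^(l + d - 1) (1 - s)^(a - d -
1)`, whose Beta integrals replace `(|β| + d - 1)!` by `(|β| + a - 1)!` (`integral_depthMeasure`).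
The operator measure is then `M(A) = ∑_δ m_δ(A) P_δ`, where `m_δ` is the product measure for depth
`δ`. -/

noncomputable section

/-! ### Depth in a single tree. -/

namespace RootedDirectedTree

variable {V : Type*} (T : RootedDirectedTree V)

lemma gen_unique {n m : ℕ} {v : V} (hn : v ∈ T.gen n) (hm : v ∈ T.gen m) : n = m := by
  induction n generalizing m v with
  | zero =>
    obtain rfl : v = T.root := hn
    cases m with
    | zero => rfl
    | succ m =>
      obtain ⟨u, -, hu⟩ := hm
      exact absurd hu (T.not_adj_root u)
  | succ n ih =>
    obtain ⟨u, hu, huv⟩ := hn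
    cases m with
    | zero =>
      obtain rfl : v = T.root := hm
      exact absurd huv (T.not_adj_root u)
    | succ m =>
      obtain ⟨u', hu', huv'⟩ := hm
      obtain rfl := T.parent_unique huv huv'
      rw [ih hu hu']

lemma depth_eq {n : ℕ} {v : V} (hn : v ∈ T.gen n) : T.depth v = n :=
  T.gen_unique (Nat.sInf_mem (s := {n | v ∈ T.gen n}) ⟨n, hn⟩) hn

lemma mem_gen_depth (v : V) : v ∈ T.gen (T.depth v) := by
  refine Nat.sInf_mem (s := {n | v ∈ T.gen n}) ?_
  induction T.reachable v with
  | refl => exact ⟨0, rfl⟩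
  | tail _ h ih =>
    obtain ⟨n, hn⟩ := ih
    exact ⟨n + 1, _, hn, h⟩

lemma depth_root : T.depth T.root = 0 := T.depth_eq rfl

lemma depth_of_mem_children {u v : V} (h : v ∈ T.children u) : T.depth v = T.depth u + 1 :=
  T.depth_eq ⟨u, T.mem_gen_depth u, h⟩

lemma parent_of_mem_children {u v : V} (h : v ∈ T.children u) : T.parent v = u := by
  have h' : ∃ u, T.Adj u v := ⟨u, h⟩
  rw [parent, dif_pos h']
  exact T.parent_unique h'.choose_spec h

lemma ne_root_of_mem_children {u v : V} (h : v ∈ T.children u) : v ≠ T.root := by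
  rintro rfl
  exact T.not_adj_root u h

lemma depth_of_mem_sib {u v : V} (hu : u ≠ T.root) (h : v ∈ T.sib u) :
    T.depth v = T.depth u := by
  rw [T.depth_of_mem_children h, T.depth_of_mem_children (T.children_of_parent hu)]

lemma exists_depth_lt_of_branching (h : T.branchingIndex ≠ ⊤) :
    ∃ n : ℕ, ∀ v ∈ T.branchingVertices, T.depth v < n := by
  obtain ⟨n, hn⟩ := ENat.ne_top_iff_exists.1 h
  refine ⟨n, fun v hv => ?_⟩
  have h1 : (1 + (T.depth v : ℕ∞)) ≤ T.branchingIndex :=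
    le_iSup₂ (f := fun w (_ : w ∈ T.branchingVertices) => 1 + (T.depth w : ℕ∞)) v hv
  rw [← hn] at h1
  have h2 : 1 + T.depth v ≤ n := by exact_mod_cast h1
  omega

end RootedDirectedTree

/-! ### Weights, shifts and their adjoints. -/

namespace TreeProduct

variable {d : ℕ} {V : Fin d → Type*} (T : ∀ j, RootedDirectedTree (V j))

lemma depth_root : depth T (root T) = 0 := funext fun j => (T j).depth_root

lemma depth_of_mem_sib {F : Finset (Fin d)} {u w : ∀ j, V j} (hu : u ∈ Phi T F)
    (hw : w ∈ sib T F u) : depth T w = depth T u := by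
  funext j
  by_cases hj : j ∈ F
  · exact (T j).depth_of_mem_sib ((hu j).1 hj) ((hw j).1 hj)
  · simp only [depth, (hw j).2 hj]

lemma depth_update {u : ∀ j, V j} {j : Fin d} {x : V j} (hx : x ∈ (T j).children (u j)) :
    depth T (Function.update u j x) = depth T u + Pi.single j 1 := by
  funext i
  by_cases hi : i = j
  · subst hi
    simp [depth, (T i).depth_of_mem_children hx]
  · simp [depth, hi]

lemma par_update {u : ∀ j, V j} {j : Fin d} {x : V j} (hx : x ∈ (T j).children (u j)) :
    par T j (Function.update u j x) = u := by
  simp [par, (T j).parent_of_mem_children hx]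

/-- The common value of `λ_j` on `Chi_j(u)`. -/
def childWeight (c : AdmissibleSeq) (j : Fin d) (u : ∀ j, V j) : ℝ :=
  √(c.toFun (absDepth T u) / (((T j).children (u j)).ncard : ℝ)) *
    √((((T j).depth (u j) : ℝ) + 1) / ((absDepth T u : ℝ) + d))

variable {T} in
lemma weight_update (c : AdmissibleSeq) {u : ∀ j, V j} {j : Fin d} {x : V j}
    (hx : x ∈ (T j).children (u j)) :
    weight T c j (Function.update u j x) = childWeight T c j u := by
  rw [weight, par_update T hx, childWeight]

variable {T}

lemma ncard_children_pos (hfin : ∀ j v, ((T j).children v).Finite) (hleaf : ∀ j, (T j).Leafless)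
    (j : Fin d) (v : V j) : (0 : ℝ) < ((T j).children v).ncard := by
  exact_mod_cast (Set.ncard_pos (hfin j v)).2 (hleaf j v)

/-- The number of children cancels, which leaves a quantity depending on the depth of `u` alone. -/
lemma childWeight_sq (hfin : ∀ j v, ((T j).children v).Finite) (hleaf : ∀ j, (T j).Leafless)
    (c : AdmissibleSeq) (j : Fin d) (u : ∀ j, V j) :
    childWeight T c j u ^ 2 * ((T j).children (u j)).ncard =
      c.toFun (absDepth T u) * ((((depth T u j : ℕ) : ℝ) + 1) / ((absDepth T u : ℝ) + d)) := by
  obtain ⟨ε, hε, hε'⟩ := c.inf_pos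
  have hc : 0 ≤ c.toFun (absDepth T u) := hε.le.trans (hε' _)
  have := ncard_children_pos hfin hleaf j (u j)
  rw [childWeight, mul_pow, Real.sq_sqrt (by positivity), Real.sq_sqrt (by positivity), depth]
  field_simp

lemma childWeight_ne_zero (hfin : ∀ j v, ((T j).children v).Finite) (hleaf : ∀ j, (T j).Leafless)
    (c : AdmissibleSeq) (j : Fin d) (u : ∀ j, V j) : childWeight T c j u ≠ 0 := by
  obtain ⟨ε, hε, hε'⟩ := c.inf_pos
  have hc : 0 < c.toFun (absDepth T u) := hε.trans_le (hε' _)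
  have hd : (0 : ℝ) < d := by exact_mod_cast Fin.pos j
  intro h
  have h2 := childWeight_sq hfin hleaf c j u
  rw [h] at h2
  have : (0 : ℝ) < c.toFun (absDepth T u) *
    ((((depth T u j : ℕ) : ℝ) + 1) / ((absDepth T u : ℝ) + d)) := by positivity
  rw [← h2] at this
  simp at this

lemma shift_apply (c : AdmissibleSeq) (j : Fin d) (f : ℓ²(∀ j, V j, ℂ)) (v : ∀ j, V j) :
    shift T c j f v = shiftFun T c j f v := rfl

lemma shift_apply_update (c : AdmissibleSeq) {j : Fin d} (f : ℓ²(∀ j, V j, ℂ)) {u : ∀ j, V j}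
    {x : V j} (hx : x ∈ (T j).children (u j)) :
    shift T c j f (Function.update u j x) = childWeight T c j u * f u := by
  rw [shift_apply, shiftFun, if_neg (by simpa using (T j).ne_root_of_mem_children hx),
    weight_update c hx, par_update T hx]

/-- As the weight is constant on the children of `u` in direction `j`, `S_j` sends the basis vector
at `u` to a multiple of the sum of the basis vectors at these children; pair this with `g`. -/
lemma adjoint_shift_apply (hfin : ∀ j v, ((T j).children v).Finite) (c : AdmissibleSeq) (j : Fin d)
    (g : ℓ²(∀ j, V j, ℂ)) (u : ∀ j, V j) :
    ContinuousLinearMap.adjoint (shift T c j) g u =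
      childWeight T c j u * ∑ x ∈ (hfin j (u j)).toFinset, g (Function.update u j x) := by
  classical
  have hS : shift T c j (lp.single 2 u (1 : ℂ)) =
      ∑ x ∈ (hfin j (u j)).toFinset,
        lp.single 2 (Function.update u j x) (childWeight T c j u : ℂ) := by
    ext v
    rw [lp.coeFn_sum, Finset.sum_apply, shift_apply, shiftFun]
    by_cases hv : ∃ x ∈ (hfin j (u j)).toFinset, v = Function.update u j x
    · obtain ⟨x, hx, rfl⟩ := hv
      have hx' : x ∈ (T j).children (u j) := by simpa using hx
      rw [if_neg (by simpa using (T j).ne_root_of_mem_children hx'), weight_update c hx',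
        par_update T hx', Finset.sum_eq_single_of_mem x hx]
      · simp
      · intro y hy hyx
        have : Function.update u j x ≠ Function.update u j y :=
          fun h => hyx (Function.update_injective u j h).symm
        rw [lp.single_apply, Pi.single_eq_of_ne this]
    · push Not at hv
      rw [Finset.sum_eq_zero (fun x hx => by
        rw [lp.single_apply, Pi.single_eq_of_ne (hv x hx)])]
      split_ifs with hr
      · rfl
      · have hne : par T j v ≠ u := by
          rintro rfl
          refine hv (v j) ?_ ?_
          · simpa [par] using (T j).children_of_parent hr
          · simp [par]
        simp [lp.single_apply, Pi.single_eq_of_ne hne]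
  have h1 : ⟪lp.single 2 u (1 : ℂ), ContinuousLinearMap.adjoint (shift T c j) g⟫_ℂ =
      ContinuousLinearMap.adjoint (shift T c j) g u := by
    rw [lp.inner_single_left]; simp
  rw [← h1, ContinuousLinearMap.adjoint_inner_right, hS, sum_inner, Finset.mul_sum]
  refine Finset.sum_congr rfl fun x _ => ?_
  rw [lp.inner_single_left]
  simp [mul_comm]

lemma inner_self_eq_ofReal_norm_sq {H : Type*} [NormedAddCommGroup H] [InnerProductSpace ℂ H]
    (x : H) : ⟪x, x⟫_ℂ = ((‖x‖ ^ 2 : ℝ) : ℂ) := by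
  rw [inner_self_eq_norm_sq_to_K]
  norm_cast

/-! ### Norms of `S^α` on functions of a single depth. -/

/-- `f` vanishes off the vertices of depth `δ`. -/
def SupportedAt (T : ∀ j, RootedDirectedTree (V j)) (f : ℓ²(∀ j, V j, ℂ)) (δ : Fin d → ℕ) : Prop :=
  ∀ v, depth T v ≠ δ → f v = 0

lemma SupportedAt.inner_eq_zero {f g : ℓ²(∀ j, V j, ℂ)} {δ ε : Fin d → ℕ}
    (hf : SupportedAt T f δ) (hg : SupportedAt T g ε) (h : δ ≠ ε) : ⟪f, g⟫_ℂ = 0 := by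
  rw [lp.inner_eq_tsum]
  refine (tsum_congr fun v => ?_).trans tsum_zero
  by_cases hv : depth T v = δ
  · rw [hg v (hv ▸ h), inner_zero_right]
  · rw [hf v hv, inner_zero_left]

lemma SupportedAt.shift {f : ℓ²(∀ j, V j, ℂ)} {δ : Fin d → ℕ} (hf : SupportedAt T f δ)
    (c : AdmissibleSeq) (j : Fin d) : SupportedAt T (shift T c j f) (δ + Pi.single j 1) := by
  intro v hv
  rw [shift_apply, shiftFun]
  split_ifs with h
  · rfl
  · rw [hf (par T j v), mul_zero]
    rintro rfl
    refine hv ?_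
    have h1 : v j ∈ (T j).children (par T j v j) := by
      simpa [par] using (T j).children_of_parent h
    rw [← depth_update T h1]
    simp [par]

/-- `S_j^* S_j` is diagonal, and its entry is the same number `κ` at all vertices of depth `δ`. -/
lemma norm_shift_sq (hfin : ∀ j v, ((T j).children v).Finite) (hleaf : ∀ j, (T j).Leafless)
    (c : AdmissibleSeq) (j : Fin d) {f : ℓ²(∀ j, V j, ℂ)} {δ : Fin d → ℕ}
    (hf : SupportedAt T f δ) :
    ‖shift T c j f‖ ^ 2 =
      c.toFun (∑ i, δ i) * ((δ j + 1) / ((∑ i, δ i : ℕ) + d)) * ‖f‖ ^ 2 := by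
  set κ : ℝ := c.toFun (∑ i, δ i) * ((δ j + 1) / ((∑ i, δ i : ℕ) + d)) with hκ
  have h1 : ContinuousLinearMap.adjoint (shift T c j) (shift T c j f) = (κ : ℂ) • f := by
    ext u
    have hsum : ∑ x ∈ (hfin j (u j)).toFinset, shift T c j f (Function.update u j x) =
        ((T j).children (u j)).ncard * (childWeight T c j u * f u) := by
      have h : ∀ x ∈ (hfin j (u j)).toFinset,
          shift T c j f (Function.update u j x) = childWeight T c j u * f u :=
        fun x hx => shift_apply_update c f ((hfin j (u j)).mem_toFinset.1 hx)
      refine (Finset.sum_congr rfl h).trans ?_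
      rw [Finset.sum_const, nsmul_eq_mul, ← Set.ncard_eq_toFinset_card _ (hfin j (u j))]
    rw [adjoint_shift_apply hfin, lp.coeFn_smul, Pi.smul_apply, smul_eq_mul, hsum]
    by_cases hu : depth T u = δ
    · have h2 := childWeight_sq hfin hleaf c j u
      rw [absDepth, hu, ← hκ] at h2
      rw [← h2]
      push_cast
      ring
    · rw [hf u hu]; simp
  have h3 : ⟪shift T c j f, shift T c j f⟫_ℂ = (κ : ℂ) * ⟪f, f⟫_ℂ := by
    rw [← ContinuousLinearMap.adjoint_inner_right, h1, inner_smul_right]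
  rw [inner_self_eq_ofReal_norm_sq, inner_self_eq_ofReal_norm_sq] at h3
  exact_mod_cast h3

/-- `A` raises the depth by `β`, and scales the norms by the ratios of the values of `G`. -/
def RaisesDepth (T : ∀ j, RootedDirectedTree (V j)) (G : (Fin d → ℕ) → ℝ) (β : Fin d → ℕ)
    (A : ℓ²(∀ j, V j, ℂ) →L[ℂ] ℓ²(∀ j, V j, ℂ)) : Prop :=
  ∀ δ f, SupportedAt T f δ →
    SupportedAt T (A f) (δ + β) ∧ ‖A f‖ ^ 2 = G (δ + β) / G δ * ‖f‖ ^ 2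

lemma RaisesDepth.one {G : (Fin d → ℕ) → ℝ} (hG : ∀ δ, G δ ≠ 0) : RaisesDepth T G 0 1 := by
  intro δ f hf
  simpa [hG δ] using hf

/-- Norm factors written as ratios of values of one function `G` telescope under composition, so
powers and products of shifts need no separate bookkeeping. -/
lemma RaisesDepth.mul {G : (Fin d → ℕ) → ℝ} (hG : ∀ δ, G δ ≠ 0) {β γ : Fin d → ℕ}
    {A B : ℓ²(∀ j, V j, ℂ) →L[ℂ] ℓ²(∀ j, V j, ℂ)} (hA : RaisesDepth T G β A)
    (hB : RaisesDepth T G γ B) : RaisesDepth T G (β + γ) (A * B) := by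
  intro δ f hf
  obtain ⟨h1, h2⟩ := hB δ f hf
  obtain ⟨h3, h4⟩ := hA _ _ h1
  rw [show δ + (β + γ) = δ + γ + β by abel, mul_apply_eq_comp, h4, h2]
  refine ⟨h3, ?_⟩
  have := hG (δ + γ)
  field_simp

lemma RaisesDepth.pow {G : (Fin d → ℕ) → ℝ} (hG : ∀ δ, G δ ≠ 0) {β : Fin d → ℕ}
    {A : ℓ²(∀ j, V j, ℂ) →L[ℂ] ℓ²(∀ j, V j, ℂ)} (hA : RaisesDepth T G β A) (n : ℕ) :
    RaisesDepth T G (n • β) (A ^ n) := by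
  induction n with
  | zero => simpa using RaisesDepth.one hG
  | succ n ih =>
    rw [pow_succ, succ_nsmul]
    exact ih.mul hG hA

lemma RaisesDepth.list_prod {G : (Fin d → ℕ) → ℝ} (hG : ∀ δ, G δ ≠ 0) {β : Fin d → Fin d → ℕ}
    {A : Fin d → ℓ²(∀ j, V j, ℂ) →L[ℂ] ℓ²(∀ j, V j, ℂ)} (hA : ∀ j, RaisesDepth T G (β j) (A j))
    (l : List (Fin d)) : RaisesDepth T G (l.map β).sum (l.map A).prod := by
  induction l with
  | nil => exact RaisesDepth.one hG
  | cons j l ih =>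
    rw [List.map_cons, List.map_cons, List.sum_cons, List.prod_cons]
    exact (hA j).mul hG ih

/-- `β! / (|β| + a - 1)!`. -/
def druryArvesonMoment (a : ℕ) (β : Fin d → ℕ) : ℝ :=
  (∏ j, ((β j).factorial : ℝ)) / ((∑ j, β j) + a - 1).factorial

lemma druryArvesonMoment_pos (a : ℕ) (β : Fin d → ℕ) : 0 < druryArvesonMoment a β := by
  rw [druryArvesonMoment]
  have : 0 < ∏ j, ((β j).factorial : ℝ) :=
    Finset.prod_pos fun j _ => by exact_mod_cast Nat.factorial_pos _
  positivity

lemma druryArvesonMoment_add_single {a : ℕ} (ha : 0 < a) (β : Fin d → ℕ) (j : Fin d) :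
    druryArvesonMoment a (β + Pi.single j 1) =
      (β j + 1) / ((∑ i, β i : ℕ) + a) * druryArvesonMoment a β := by
  have h1 : ∏ i, (((β + Pi.single j 1 : Fin d → ℕ) i).factorial : ℝ) =
      (β j + 1) * ∏ i, ((β i).factorial : ℝ) := by
    rw [← Finset.mul_prod_erase _ _ (Finset.mem_univ j),
      ← Finset.mul_prod_erase _ (fun i => ((β i).factorial : ℝ)) (Finset.mem_univ j),
      ← mul_assoc]
    congr 1
    · simp [Nat.factorial_succ]
    · refine Finset.prod_congr rfl fun i hi => ?_
      simp [Finset.ne_of_mem_erase hi]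
  have h2 : ∑ i, (β + Pi.single j 1 : Fin d → ℕ) i = (∑ i, β i) + 1 := by
    simp [Finset.sum_add_distrib]
  have h3 : (∑ i, β i) + 1 + a - 1 = ((∑ i, β i) + a - 1) + 1 := by omega
  have h4 : (((∑ i, β i) + a - 1 : ℕ) : ℝ) + 1 = (∑ i, β i : ℕ) + a := by
    rw [← Nat.cast_add, ← Nat.cast_succ]
    congr 1
    omega
  rw [druryArvesonMoment, druryArvesonMoment, h1, h2, h3, Nat.factorial_succ]
  push_cast at h4 ⊢
  rw [h4, div_mul_div_comm]

lemma raisesDepth_shiftPow (hfin : ∀ j v, ((T j).children v).Finite) (hleaf : ∀ j, (T j).Leafless)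
    (hd : 0 < d) {a : ℕ} (ha : 0 < a) (α : Fin d → ℕ) :
    RaisesDepth T (druryArvesonMoment a) α
      (shiftPow T (druryArvesonSeq d a hd (Nat.cast_pos.2 ha)) α) := by
  set c := druryArvesonSeq d a hd (Nat.cast_pos.2 ha)
  have hG : ∀ δ : Fin d → ℕ, druryArvesonMoment a δ ≠ 0 :=
    fun δ => (druryArvesonMoment_pos a δ).ne'
  have h1 : ∀ j, RaisesDepth T (druryArvesonMoment a) (Pi.single j 1) (shift T c j) := by
    intro j δ f hf
    refine ⟨hf.shift c j, ?_⟩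
    rw [norm_shift_sq hfin hleaf c j hf, druryArvesonMoment_add_single ha,
      mul_div_cancel_right₀ _ (hG δ)]
    congr 1
    -- The numerator `|δ| + d` of `c_a` cancels the denominator in the Drury–Arveson weight.
    change ((∑ i, δ i : ℕ) + (d : ℝ)) / ((∑ i, δ i : ℕ) + (a : ℝ)) * _ = _
    have : (0 : ℝ) < (∑ i, δ i : ℕ) + d := by positivity
    field_simp
  have h2 := RaisesDepth.list_prod hG (fun j => (h1 j).pow hG (α j)) (List.finRange d)
  rw [← List.ofFn_eq_map, ← List.ofFn_eq_map, List.sum_ofFn] at h2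
  have h3 : ∑ j, α j • (Pi.single j 1 : Fin d → ℕ) = α := by
    rw [← Finset.univ_sum_single α]
    refine Finset.sum_congr rfl fun j _ => ?_
    rw [← Pi.single_smul]
    simp
  rwa [h3] at h2

/-! ### Depth components -/

open Classical in
/-- Multiplication by the indicator function of the vertices of depth `δ`. -/
def depthProj (T : ∀ j, RootedDirectedTree (V j)) (δ : Fin d → ℕ) :
    ℓ²(∀ j, V j, ℂ) →L[ℂ] ℓ²(∀ j, V j, ℂ) :=
  LinearMap.mkContinuous
    { toFun := fun f => ⟨fun v => if depth T v = δ then f v else 0, by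
        refine memℓp_gen ?_
        refine Summable.of_nonneg_of_le (fun _ => by positivity) (fun v => ?_) (summable_sq f)
        split_ifs <;> simp⟩
      map_add' := fun f g => by
        ext v
        change (if _ then f v + g v else 0) = (if _ then f v else 0) + (if _ then g v else 0)
        split_ifs <;> simp
      map_smul' := fun a f => by
        ext v
        change (if _ then a * f v else 0) = a * (if _ then f v else 0)
        split_ifs <;> simp }
    1 (fun f => by
      have hp : 0 < (2 : ℝ≥0∞).toReal := by norm_num
      refine lp.norm_le_of_forall_sum_le hp (by positivity) fun s => ?_
      rw [one_mul]
      refine le_trans (Finset.sum_le_sum fun v _ => ?_) (lp.sum_rpow_le_norm_rpow hp f s)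
      gcongr
      change ‖if depth T v = δ then f v else 0‖ ≤ _
      split_ifs <;> simp)

open Classical in
lemma depthProj_apply (δ : Fin d → ℕ) (f : ℓ²(∀ j, V j, ℂ)) (v : ∀ j, V j) :
    depthProj T δ f v = if depth T v = δ then f v else 0 := rfl

lemma supportedAt_depthProj (δ : Fin d → ℕ) (f : ℓ²(∀ j, V j, ℂ)) :
    SupportedAt T (depthProj T δ f) δ := fun v hv => by
  rw [depthProj_apply, if_neg hv]

lemma SupportedAt.depthProj_eq {δ : Fin d → ℕ} {f : ℓ²(∀ j, V j, ℂ)} (hf : SupportedAt T f δ)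
    (ε : Fin d → ℕ) : depthProj T ε f = if δ = ε then f else 0 := by
  ext v
  rw [depthProj_apply]
  by_cases hv : depth T v = δ
  · subst hv
    split_ifs <;> rfl
  · split_ifs <;> simp [hf v hv]

lemma mem_jointKernel_iff (hfin : ∀ j v, ((T j).children v).Finite) (hleaf : ∀ j, (T j).Leafless)
    (c : AdmissibleSeq) (f : ℓ²(∀ j, V j, ℂ)) :
    f ∈ jointKernel T c ↔
      ∀ j u, ∑ x ∈ (hfin j (u j)).toFinset, f (Function.update u j x) = 0 := by
  rw [jointKernel, Submodule.mem_iInf]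
  refine forall_congr' fun j => ?_
  rw [LinearMap.mem_ker]
  have hw : ∀ u, (childWeight T c j u : ℂ) ≠ 0 := fun u => by
    exact_mod_cast childWeight_ne_zero hfin hleaf c j u
  constructor
  · intro h u
    have h1 := adjoint_shift_apply hfin c j f u
    rw [show ContinuousLinearMap.adjoint (shift T c j) f = 0 from h] at h1
    simpa [hw u] using h1.symm
  · intro h
    refine lp.ext (funext fun u => ?_)
    refine (adjoint_shift_apply hfin c j f u).trans ?_
    rw [h u, mul_zero]
    rfl

/-- The children of `u` in direction `j` share one depth, so each sum defining the kernel is kept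
whole or erased whole. -/
lemma depthProj_mem_jointKernel (hfin : ∀ j v, ((T j).children v).Finite)
    (hleaf : ∀ j, (T j).Leafless) (c : AdmissibleSeq) (δ : Fin d → ℕ) {f : ℓ²(∀ j, V j, ℂ)}
    (hf : f ∈ jointKernel T c) : depthProj T δ f ∈ jointKernel T c := by
  rw [mem_jointKernel_iff hfin hleaf] at hf ⊢
  intro j u
  by_cases h : depth T u + Pi.single j 1 = δ
  · rw [← hf j u]
    refine Finset.sum_congr rfl fun x hx => ?_
    rw [depthProj_apply, depth_update T (by simpa using hx), if_pos h]
  · refine Finset.sum_eq_zero fun x hx => ?_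
    rw [depthProj_apply, depth_update T (by simpa using hx), if_neg h]

/-- If some `v_j` lies below all branching vertices of its tree, it is an only child, and the kernel
condition at `par_j(v)` reads `f v = 0`. This makes all later sums over depths finite. -/
lemma exists_depth_bound (hfin : ∀ j v, ((T j).children v).Finite) (hleaf : ∀ j, (T j).Leafless)
    (hbranch : ∀ j, (T j).branchingIndex ≠ ⊤) (c : AdmissibleSeq) :
    ∃ N : Fin d → ℕ, ∀ f ∈ jointKernel T c, ∀ v, f v ≠ 0 → depth T v ≤ N := by
  choose N hN using fun j => (T j).exists_depth_lt_of_branching (hbranch j)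
  refine ⟨N, fun f hf v hv j => ?_⟩
  rw [mem_jointKernel_iff hfin hleaf] at hf
  by_contra! hlt
  have hr : v j ≠ (T j).root := by
    intro h
    simp [depth, h, (T j).depth_root] at hlt
  have hmem := (T j).children_of_parent hr
  -- The parent has depth at least `N j`, whereas branching vertices have depth less than `N j`.
  have hnb : (T j).parent (v j) ∉ (T j).branchingVertices := by
    intro h
    have h1 := hN j _ h
    have h2 := (T j).depth_of_mem_children hmem
    simp only [depth] at hlt
    omega
  have hsub : ((T j).children ((T j).parent (v j))).Subsingleton := by
    rw [← Set.encard_le_one_iff_subsingleton]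
    by_contra! h
    exact hnb (Order.add_one_le_of_lt h)
  have h0 := hf j (par T j v)
  have hset : (hfin j (par T j v j)).toFinset = {v j} := by
    ext x
    simp only [par, Function.update_self, Set.Finite.mem_toFinset, Finset.mem_singleton]
    exact ⟨fun hx => hsub hx hmem, fun hx => hx ▸ hmem⟩
  rw [hset, Finset.sum_singleton] at h0
  exact hv (by simpa [par] using h0)

/-- The depth component `depthProj T δ`, as an operator on the joint kernel. -/
def kernelProj (hfin : ∀ j v, ((T j).children v).Finite) (hleaf : ∀ j, (T j).Leafless)
    (c : AdmissibleSeq) (δ : Fin d → ℕ) : jointKernel T c →L[ℂ] jointKernel T c :=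
  ((depthProj T δ).comp (jointKernel T c).subtypeL).codRestrict (jointKernel T c)
    fun f => depthProj_mem_jointKernel hfin hleaf c δ f.2

lemma coe_kernelProj (hfin : ∀ j v, ((T j).children v).Finite) (hleaf : ∀ j, (T j).Leafless)
    (c : AdmissibleSeq) (δ : Fin d → ℕ) (f : jointKernel T c) :
    (kernelProj hfin hleaf c δ f : ℓ²(∀ j, V j, ℂ)) = depthProj T δ f := rfl

lemma sum_kernelProj (hfin : ∀ j v, ((T j).children v).Finite) (hleaf : ∀ j, (T j).Leafless)
    (c : AdmissibleSeq) {N : Fin d → ℕ}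
    (hN : ∀ f ∈ jointKernel T c, ∀ v, f v ≠ 0 → depth T v ≤ N) (f : jointKernel T c) :
    ∑ δ ∈ Finset.Iic N, kernelProj hfin hleaf c δ f = f := by
  refine Subtype.ext (lp.ext (funext fun v => ?_))
  rw [Submodule.coe_sum, lp.coeFn_sum, Finset.sum_apply]
  simp only [coe_kernelProj, depthProj_apply, Finset.sum_ite_eq, Finset.mem_Iic]
  split_ifs with h
  · rfl
  · by_contra h0
    exact h (Finset.mem_Iic.2 (hN f f.2 v (fun h' => h0 h'.symm)))

lemma inner_kernelProj (hfin : ∀ j v, ((T j).children v).Finite) (hleaf : ∀ j, (T j).Leafless)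
    (c : AdmissibleSeq) (δ : Fin d → ℕ) (f : jointKernel T c) :
    ⟪f, kernelProj hfin hleaf c δ f⟫_ℂ = ((‖kernelProj hfin hleaf c δ f‖ ^ 2 : ℝ) : ℂ) := by
  have h : ⟪f, kernelProj hfin hleaf c δ f⟫_ℂ =
      ⟪kernelProj hfin hleaf c δ f, kernelProj hfin hleaf c δ f⟫_ℂ := by
    rw [Submodule.coe_inner, Submodule.coe_inner, coe_kernelProj, lp.inner_eq_tsum,
      lp.inner_eq_tsum]
    refine tsum_congr fun v => ?_
    rw [depthProj_apply]
    split_ifs <;> simp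
  rw [h, inner_self_eq_ofReal_norm_sq]

/-- Pythagoras: the components of `f` at distinct depths `δ` are moved to distinct depths `δ + α`,
hence stay orthogonal. -/
lemma norm_shiftPow_sq (hfin : ∀ j v, ((T j).children v).Finite) (hleaf : ∀ j, (T j).Leafless)
    (c : AdmissibleSeq) {G : (Fin d → ℕ) → ℝ} {α : Fin d → ℕ}
    (hS : RaisesDepth T G α (shiftPow T c α)) {N : Fin d → ℕ}
    (hN : ∀ f ∈ jointKernel T c, ∀ v, f v ≠ 0 → depth T v ≤ N) (f : jointKernel T c) :
    ‖shiftPow T c α f‖ ^ 2 =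
      ∑ δ ∈ Finset.Iic N, ‖kernelProj hfin hleaf c δ f‖ ^ 2 * (G (δ + α) / G δ) := by
  have hf : shiftPow T c α f = ∑ δ ∈ Finset.Iic N, shiftPow T c α (depthProj T δ f) := by
    conv_lhs => rw [← sum_kernelProj hfin hleaf c hN f, Submodule.coe_sum, map_sum]
    rfl
  have h1 : ⟪shiftPow T c α f, shiftPow T c α f⟫_ℂ =
      ∑ δ ∈ Finset.Iic N, ⟪shiftPow T c α (depthProj T δ f), shiftPow T c α (depthProj T δ f)⟫_ℂ := by
    rw [hf, sum_inner]
    refine Finset.sum_congr rfl fun δ hδ => ?_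
    rw [inner_sum, Finset.sum_eq_single_of_mem δ hδ]
    intro ε _ hε
    refine (hS _ _ (supportedAt_depthProj δ _)).1.inner_eq_zero
      (hS _ _ (supportedAt_depthProj ε _)).1 fun h => hε ?_
    exact (add_right_cancel h).symm
  simp only [inner_self_eq_ofReal_norm_sq] at h1
  have h2 : ‖shiftPow T c α f‖ ^ 2 =
      ∑ δ ∈ Finset.Iic N, ‖shiftPow T c α (depthProj T δ f)‖ ^ 2 := by exact_mod_cast h1
  rw [h2]
  refine Finset.sum_congr rfl fun δ _ => ?_
  rw [(hS _ _ (supportedAt_depthProj δ _)).2, mul_comm]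
  rfl

end TreeProduct

/-! ### Uniqueness of coefficients, and the norm of a monomial in the model. -/

lemma eq_zero_of_hasSum_pow_mul {a : ℕ → ℂ}
    (h : ∀ t : ℂ, ‖t‖ < 1 → HasSum (fun n => t ^ n * a n) 0) : a = 0 := by
  have h1 : HasFPowerSeriesOnBall (0 : ℂ → ℂ)
      (fun n => ContinuousMultilinearMap.mkPiRing ℂ (Fin n) (a n)) 0 1 := by
    refine ⟨?_, one_pos, fun {y} hy => ?_⟩
    · refine ENNReal.le_of_forall_nnreal_lt fun r hr => ?_
      have hr' : ‖((r : ℝ) : ℂ)‖ < 1 := by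
        simpa using hr
      -- Convergence at the point `r` makes the terms tend to zero, which bounds the radius from
      -- below by `r`.
      refine FormalMultilinearSeries.le_radius_of_tendsto _ (l := 0) ?_
      have h2 := (h _ hr').summable.tendsto_atTop_zero.norm
      simpa [mul_comm] using h2
    · have hy1 : ‖y‖₊ < 1 := by simpa [enorm_eq_nnnorm] using hy
      have hy' : ‖y‖ < 1 := by exact_mod_cast hy1
      simpa using h y hy'
  have h2 := h1.hasFPowerSeriesAt.eq_zero
  funext n
  have h3 := congrArg (fun p : FormalMultilinearSeries ℂ ℂ ℂ => p n (fun _ => 1)) h2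
  simpa using h3

namespace TreeProduct

variable {d : ℕ}

lemma monom_smul (t : ℂ) (z : EuclideanSpace ℂ (Fin d)) (β : Fin d → ℕ) :
    monom (t • z) β = t ^ (∑ j, β j) * monom z β := by
  simp only [monom, PiLp.smul_apply, smul_eq_mul, mul_pow, Finset.prod_mul_distrib,
    Finset.prod_pow_eq_pow_sum]

/-- Along the disc `t ↦ t • z` the sum is a power series in `t` whose coefficients are the
homogeneous parts at `z`. One-variable uniqueness kills each of them on the ball, and a polynomial
vanishing as a function over `ℂ` is zero. -/
lemma eq_zero_of_hasSum_monom_mul {h : (Fin d → ℕ) → ℂ}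
    (hh : ∀ z : EuclideanSpace ℂ (Fin d), ‖z‖ < 1 → HasSum (fun β => monom z β * h β) 0) :
    h = 0 := by
  have key : ∀ (n : ℕ) (z : EuclideanSpace ℂ (Fin d)), ‖z‖ < 1 →
      ∑ β ∈ Finset.piAntidiag Finset.univ n, monom z β * h β = 0 := by
    intro n z hz
    have h1 : (fun n => ∑ β ∈ Finset.piAntidiag Finset.univ n, monom z β * h β) = 0 := by
      refine eq_zero_of_hasSum_pow_mul fun t ht => ?_
      have h2 := hh (t • z) (by
        rw [norm_smul]
        exact mul_lt_one_of_nonneg_of_lt_one_left (norm_nonneg _) ht hz.le)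
      -- Regroup the multi-indices by total degree.
      have h3 := ((Equiv.sigmaFiberEquiv fun β : Fin d → ℕ => ∑ j, β j).hasSum_iff.2 h2).sigma
        (g := fun n => t ^ n * ∑ β ∈ Finset.piAntidiag Finset.univ n, monom z β * h β) ?_
      · exact h3
      · intro n
        have hmem : ∀ β : Fin d → ℕ, β ∈ Finset.piAntidiag Finset.univ n ↔ ∑ j, β j = n := by
          simp
        have h4 := Finset.hasSum (Finset.piAntidiag Finset.univ n)
          (fun β => monom (t • z) β * h β)
        have h5 : HasSum (fun β : {β : Fin d → ℕ // ∑ j, β j = n} => monom (t • z) β.1 * h β.1)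
            (∑ β ∈ Finset.piAntidiag Finset.univ n, monom (t • z) β * h β) :=
          (Equiv.subtypeEquivRight hmem).hasSum_iff.1 h4
        convert! h5 using 1
        rw [Finset.mul_sum]
        refine Finset.sum_congr rfl fun β hβ => ?_
        rw [monom_smul, (hmem β).1 hβ, mul_assoc]
    exact congrFun h1 n
  funext β₀
  set n := ∑ j, β₀ j with hn
  have hP : ∑ β ∈ Finset.piAntidiag Finset.univ n,
      MvPolynomial.monomial (Finsupp.equivFunOnFinite.symm β) (h β) = 0 := by
    refine MvPolynomial.funext fun x => ?_
    set z : EuclideanSpace ℂ (Fin d) := WithLp.toLp 2 x with hz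
    have ht : ((‖z‖ + 1 : ℝ) : ℂ) ≠ 0 := by
      exact_mod_cast (by positivity : (0 : ℝ) < ‖z‖ + 1).ne'
    -- Scaling by `1 / (‖z‖ + 1)` brings `z` into the ball; by homogeneity this costs only a nonzero
    -- factor.
    have h1 := key n (((‖z‖ + 1 : ℝ) : ℂ)⁻¹ • z) (by
      rw [norm_smul, norm_inv, Complex.norm_real, Real.norm_of_nonneg (by positivity),
        inv_mul_lt_one₀ (by positivity)]
      linarith)
    have h2 : ∑ β ∈ Finset.piAntidiag Finset.univ n, monom z β * h β = 0 := by
      have h3 : (((‖z‖ + 1 : ℝ) : ℂ)⁻¹) ^ n *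
          ∑ β ∈ Finset.piAntidiag Finset.univ n, monom z β * h β = 0 := by
        rw [← h1, Finset.mul_sum]
        refine Finset.sum_congr rfl fun β hβ => ?_
        rw [monom_smul, (Finset.mem_piAntidiag.1 hβ).1, mul_assoc]
      exact (mul_eq_zero.1 h3).resolve_left (pow_ne_zero _ (inv_ne_zero ht))
    rw [map_sum, map_zero, ← h2]
    refine Finset.sum_congr rfl fun β _ => ?_
    rw [MvPolynomial.eval_monomial, mul_comm, monom, Finsupp.prod_fintype _ _ (by simp)]
    rfl
  have h1 := congrArg (MvPolynomial.coeff (Finsupp.equivFunOnFinite.symm β₀)) hP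
  rw [MvPolynomial.coeff_sum, MvPolynomial.coeff_zero,
    Finset.sum_eq_single_of_mem β₀ (by simp [hn])] at h1
  · simpa using h1
  · intro β _ hβ
    rw [MvPolynomial.coeff_monomial, if_neg]
    exact fun h => hβ (Finsupp.equivFunOnFinite.symm.injective h)

variable {V : Fin d → Type*} {T : ∀ j, RootedDirectedTree (V j)}

/-- Needed because `coeff` is a choice of coefficients. Pairing with vectors of `E` reduces the
claim to scalar series. -/
lemma IsCoeff.unique {c : AdmissibleSeq}
    {G : Metric.ball (0 : EuclideanSpace ℂ (Fin d)) 1 → jointKernel T c}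
    {f g : (Fin d → ℕ) → jointKernel T c} (hf : IsCoeff T c G f) (hg : IsCoeff T c G g) :
    f = g := by
  have key : ∀ e : jointKernel T c, (fun β => ⟪e, f β - g β⟫_ℂ) = 0 := by
    intro e
    refine eq_zero_of_hasSum_monom_mul fun z hz => ?_
    have hz' : z ∈ Metric.ball (0 : EuclideanSpace ℂ (Fin d)) 1 := by simpa using hz
    have h1 := ((hf.2 ⟨z, hz'⟩).sub (hg.2 ⟨z, hz'⟩)).mapL (innerSL ℂ e)
    simpa [← smul_sub, inner_smul_right, inner_sub_right] using h1
  funext β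
  exact sub_eq_zero.1 (inner_self_eq_zero (𝕜 := ℂ).1 (congrFun (key (f β - g β)) β))

lemma coeff_monomial [DecidableEq (Fin d → ℕ)] (c : AdmissibleSeq) (α : Fin d → ℕ)
    (f : jointKernel T c) :
    coeff T (monomial T c 1 α f) = Pi.single α f := by
  refine IsCoeff.unique (monomial T c 1 α f).2.choose_spec ⟨?_, fun z => ?_⟩
  · refine summable_of_ne_finset_zero (s := {α}) fun β hβ => ?_
    rw [Finset.mem_singleton] at hβ
    simp [Pi.single_eq_of_ne hβ]
  · have := hasSum_single (f := fun β => monom z.1 β • (Pi.single α f : _ → jointKernel T c) β) α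
      (fun β hβ => by simp [Pi.single_eq_of_ne hβ])
    simpa [monomial] using this

lemma modelNorm_monomial_sq (c : AdmissibleSeq) (α : Fin d → ℕ) (f : jointKernel T c) :
    modelNorm T (monomial T c 1 α f) ^ 2 = ‖shiftPow T c α f‖ ^ 2 := by
  classical
  have h : modelInner T (monomial T c 1 α f) (monomial T c 1 α f) =
      ⟪shiftPow T c α f, shiftPow T c α f⟫_ℂ := by
    rw [modelInner, coeff_monomial, tsum_eq_single α]
    · simp
    · intro β hβ
      simp [Pi.single_eq_of_ne hβ]
  rw [modelNorm, h, Real.sq_sqrt inner_self_nonneg, inner_self_eq_norm_sq]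

end TreeProduct

/-! ### Moments of the surface measure, by Gaussian integration. -/

namespace TreeProduct

variable {d : ℕ}

lemma monom_add (z : EuclideanSpace ℂ (Fin d)) (α β : Fin d → ℕ) :
    monom z (α + β) = monom z α * monom z β := by
  simp [monom, pow_add, Finset.prod_mul_distrib]

lemma monom_zero (z : EuclideanSpace ℂ (Fin d)) : monom z 0 = 1 := by
  simp [monom]

lemma norm_monom_sq (z : EuclideanSpace ℂ (Fin d)) (β : Fin d → ℕ) :
    ‖monom z β‖ ^ 2 = ∏ j, ‖z j‖ ^ (2 * β j) := by
  rw [monom, norm_prod, ← Finset.prod_pow]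
  refine Finset.prod_congr rfl fun j _ => ?_
  rw [norm_pow, ← pow_mul, mul_comm]

lemma continuous_monom (β : Fin d → ℕ) :
    Continuous fun z : EuclideanSpace ℂ (Fin d) => monom z β := by
  unfold monom
  fun_prop

lemma integral_complex_pow_mul_gaussian (k : ℕ) :
    ∫ z : ℂ, ‖z‖ ^ (2 * k) * Real.exp (-‖z‖ ^ 2) = Real.pi * k.factorial := by
  have h := Complex.integral_rpow_mul_exp_neg_rpow (p := 2) (q := (2 * k : ℕ)) one_le_two
    (by have : (0 : ℝ) ≤ (2 * k : ℕ) := Nat.cast_nonneg _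
        linarith)
  simp only [Real.rpow_natCast, Real.rpow_two] at h
  rw [h, show (((2 * k : ℕ) : ℝ) + 2) / 2 = k + 1 by push_cast; ring, Real.Gamma_nat_eq_factorial]
  ring

/-- The integrand factors over the coordinates. The volume of the Euclidean space is transported to
a Haar measure, hence to a multiple of the product volume; the constant need not be known, since it
drops out on comparison with `β = 0`. -/
lemma integral_norm_monom_sq_mul_gaussian (d : ℕ) :
    ∃ C : ℝ, 0 < C ∧ ∀ β : Fin d → ℕ,
      ∫ z : EuclideanSpace ℂ (Fin d), ‖monom z β‖ ^ 2 * Real.exp (-‖z‖ ^ 2) =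
        C * ∏ j, ((β j).factorial : ℝ) := by
  set e : EuclideanSpace ℂ (Fin d) ≃L[ℂ] (Fin d → ℂ) := EuclideanSpace.equiv (Fin d) ℂ
  set μ : Measure (Fin d → ℂ) := (volume : Measure (EuclideanSpace ℂ (Fin d))).map e
  have hμ : μ.IsAddHaarMeasure := e.isAddHaarMeasure_map _
  set k := μ.addHaarScalarFactor volume
  have hk : 0 < k := Measure.addHaarScalarFactor_pos_of_isAddHaarMeasure _ _
  have hμk : μ = k • volume := Measure.isAddLeftInvariant_eq_smul _ _
  refine ⟨k * Real.pi ^ d, by positivity, fun β => ?_⟩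
  set F : (Fin d → ℂ) → ℝ := fun y => ∏ j, (‖y j‖ ^ (2 * β j) * Real.exp (-‖y j‖ ^ 2)) with hF
  have h1 : ∀ z : EuclideanSpace ℂ (Fin d),
      ‖monom z β‖ ^ 2 * Real.exp (-‖z‖ ^ 2) = F (e z) := by
    intro z
    simp only [hF]
    rw [Finset.prod_mul_distrib, ← Real.exp_sum, Finset.sum_neg_distrib, norm_monom_sq,
      EuclideanSpace.norm_sq_eq]
    rfl
  have h2 : ∫ z : EuclideanSpace ℂ (Fin d), F (e z) = ∫ y, F y ∂μ :=
    (e.toHomeomorph.measurableEmbedding.integral_map F).symm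
  simp_rw [h1]
  rw [h2, hμk, integral_smul_nnreal_measure, hF,
    integral_fintype_prod_volume_eq_prod
      (fun j (y : ℂ) => ‖y‖ ^ (2 * β j) * Real.exp (-‖y‖ ^ 2))]
  simp_rw [integral_complex_pow_mul_gaussian]
  rw [Finset.prod_mul_distrib, Finset.prod_const, Finset.card_univ, Fintype.card_fin,
    NNReal.smul_def, smul_eq_mul, mul_assoc]

lemma integral_Ioi_pow_mul_gaussian (n : ℕ) :
    ∫ r in Ioi (0 : ℝ), r ^ (2 * n + 1) * Real.exp (-r ^ 2) = n.factorial / 2 := by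
  have h := integral_rpow_mul_exp_neg_rpow (p := 2) (q := (2 * n + 1 : ℕ)) two_pos
    (by have : (0 : ℝ) ≤ (2 * n + 1 : ℕ) := Nat.cast_nonneg _
        linarith)
  simp only [Real.rpow_natCast, Real.rpow_two] at h
  rw [h, show (((2 * n + 1 : ℕ) : ℝ) + 1) / 2 = n + 1 by push_cast; ring,
    Real.Gamma_nat_eq_factorial]
  ring

lemma finrank_real_euclideanSpace_complex (d : ℕ) :
    Module.finrank ℝ (EuclideanSpace ℂ (Fin d)) = 2 * d := by
  rw [← Module.finrank_mul_finrank ℝ ℂ, Complex.finrank_real_complex, finrank_euclideanSpace_fin]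

/-- Polar coordinates: `|z^β|²` is homogeneous of degree `2|β|`, which separates the radial
integral. -/
lemma integral_eq_integral_toSphere_mul (hd : 0 < d) (β : Fin d → ℕ) :
    ∫ z : EuclideanSpace ℂ (Fin d), ‖monom z β‖ ^ 2 * Real.exp (-‖z‖ ^ 2) =
      (∫ ζ : Sphere d, ‖monom ζ.1 β‖ ^ 2
        ∂(volume : Measure (EuclideanSpace ℂ (Fin d))).toSphere) *
        ((((∑ j, β j) + d - 1).factorial : ℝ) / 2) := by
  have : Nonempty (Fin d) := ⟨⟨0, hd⟩⟩
  set E := EuclideanSpace ℂ (Fin d)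
  set μ : Measure E := volume
  set F : E → ℝ := fun z => ‖monom z β‖ ^ 2 * Real.exp (-‖z‖ ^ 2) with hF
  calc ∫ z, F z ∂μ = ∫ z : ({0}ᶜ : Set E), F z ∂(μ.comap (↑)) := by
        rw [integral_subtype_comap (measurableSet_singleton _).compl F, restrict_compl_singleton]
    _ = ∫ p : Sphere d × Ioi (0 : ℝ), F (p.2.1 • p.1.1)
          ∂(μ.toSphere.prod (.volumeIoiPow (Module.finrank ℝ E - 1))) := by
        rw [← μ.measurePreserving_homeomorphUnitSphereProd.integral_comp
          (Homeomorph.measurableEmbedding _)]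
        refine integral_congr_ae (.of_forall fun z => ?_)
        have h := homeomorphUnitSphereProd_symm_apply_coe E (homeomorphUnitSphereProd E z)
        rw [Homeomorph.symm_apply_apply] at h
        exact congrArg F h
    _ = ∫ p : Sphere d × Ioi (0 : ℝ),
          ‖monom p.1.1 β‖ ^ 2 * (p.2.1 ^ (2 * ∑ j, β j) * Real.exp (-p.2.1 ^ 2))
          ∂(μ.toSphere.prod (.volumeIoiPow (Module.finrank ℝ E - 1))) := by
        refine integral_congr_ae (.of_forall fun p => ?_)
        have h1 : ‖p.1.1‖ = 1 := by simp
        have h2 : ‖p.2.1 • p.1.1‖ = p.2.1 := by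
          rw [norm_smul, h1, mul_one, Real.norm_of_nonneg p.2.2.le]
        have h3 : monom (p.2.1 • p.1.1) β = (p.2.1 : ℂ) ^ (∑ j, β j) * monom p.1.1 β := by
          rw [← monom_smul]
          congr 1
        simp only [hF]
        rw [h2, h3, norm_mul, norm_pow, Complex.norm_real, Real.norm_of_nonneg p.2.2.le]
        ring
    _ = (∫ ζ : Sphere d, ‖monom ζ.1 β‖ ^ 2 ∂μ.toSphere) *
          ∫ r : Ioi (0 : ℝ), r.1 ^ (2 * ∑ j, β j) * Real.exp (-r.1 ^ 2)
            ∂(.volumeIoiPow (Module.finrank ℝ E - 1)) :=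
        integral_prod_mul (fun ζ : Sphere d => ‖monom ζ.1 β‖ ^ 2)
          fun r : Ioi (0 : ℝ) => r.1 ^ (2 * ∑ j, β j) * Real.exp (-r.1 ^ 2)
    _ = _ := by
        congr 1
        simp only [Measure.volumeIoiPow, ENNReal.ofReal]
        rw [integral_withDensity_eq_integral_smul
            ((measurable_subtype_coe.pow_const _).real_toNNReal),
          integral_subtype_comap measurableSet_Ioi fun r : ℝ =>
            Real.toNNReal (r ^ (Module.finrank ℝ E - 1)) •
              (r ^ (2 * ∑ j, β j) * Real.exp (-r ^ 2)),
          ← integral_Ioi_pow_mul_gaussian]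
        refine setIntegral_congr_fun measurableSet_Ioi fun r hr => ?_
        have hr0 : (0 : ℝ) ≤ r := le_of_lt hr
        simp only [NNReal.smul_def, smul_eq_mul]
        -- The real dimension is `2d`, so the power of `r` is `2d - 1 + 2|β| = 2(|β| + d - 1) + 1`.
        rw [Real.coe_toNNReal _ (pow_nonneg hr0 _), ← mul_assoc, ← pow_add,
          finrank_real_euclideanSpace_complex]
        congr 2
        omega

instance isProbabilityMeasure_sphereMeasure [NeZero d] :
    IsProbabilityMeasure (sphereMeasure d) := by
  have : Nonempty (Fin d) := ⟨0⟩
  constructor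
  rw [sphereMeasure, Measure.smul_apply, smul_eq_mul]
  refine ENNReal.inv_mul_cancel ?_ (measure_ne_top _ _)
  rw [Ne, Measure.measure_univ_eq_zero]
  exact Measure.toSphere_ne_zero _

lemma integral_sphereMeasure_norm_monom_sq [NeZero d] (β : Fin d → ℕ) :
    ∫ ζ, ‖monom ζ.1 β‖ ^ 2 ∂sphereMeasure d =
      (d - 1).factorial * ((∏ j, ((β j).factorial : ℝ)) / ((∑ j, β j) + d - 1).factorial) := by
  obtain ⟨C, hC, h⟩ := integral_norm_monom_sq_mul_gaussian d
  set μ : Measure (Sphere d) := (volume : Measure (EuclideanSpace ℂ (Fin d))).toSphere with hμ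
  have h1 : ∀ β : Fin d → ℕ, ∫ ζ, ‖monom ζ.1 β‖ ^ 2 ∂sphereMeasure d =
      (μ univ)⁻¹.toReal * (2 * C) *
        ((∏ j, ((β j).factorial : ℝ)) / ((∑ j, β j) + d - 1).factorial) := by
    intro β
    have h2 := (integral_eq_integral_toSphere_mul (NeZero.pos d) β).symm.trans (h β)
    have hf : (((∑ j, β j) + d - 1).factorial : ℝ) ≠ 0 := by positivity
    have h3 : ∫ ζ : Sphere d, ‖monom ζ.1 β‖ ^ 2 ∂μ =
        2 * C * ((∏ j, ((β j).factorial : ℝ)) / ((∑ j, β j) + d - 1).factorial) := by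
      field_simp at h2 ⊢
      linarith
    rw [sphereMeasure, integral_smul_measure, h3, smul_eq_mul]
    exact (mul_assoc _ _ _).symm
  -- For `β = 0` the integral is the total mass `1`, which determines the unknown constant.
  have h0 := h1 0
  simp only [monom_zero, norm_one, one_pow, integral_const, probReal_univ, smul_eq_mul, mul_one,
    Pi.zero_apply, Nat.factorial_zero, Nat.cast_one, Finset.prod_const_one,
    Finset.sum_const_zero, zero_add] at h0
  have hf : ((d - 1).factorial : ℝ) ≠ 0 := by positivity
  rw [h1 β]
  congr 1
  field_simp at h0
  linarith

end TreeProduct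

/-! ### The radial weight and its moments. -/

lemma prod_Ico_sub_right (d i : ℕ) (h : d ≤ i) :
    ∏ j ∈ Finset.Ico d i, ((j : ℝ) - i) = (-1) ^ (i - d) * (i - d).factorial := by
  obtain ⟨p, rfl⟩ := Nat.exists_eq_add_of_le h
  rw [Finset.prod_Ico_eq_prod_range, Nat.add_sub_cancel_left, ← Finset.prod_range_reflect,
    ← Finset.prod_range_add_one_eq_factorial, Nat.cast_prod]
  conv_rhs => rw [← Finset.card_range p, ← Finset.prod_const, Finset.card_range,
    ← Finset.prod_mul_distrib]
  refine Finset.prod_congr rfl fun k hk => ?_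
  have hk' : k < p := Finset.mem_range.1 hk
  have h1 : ((p - 1 - k : ℕ) : ℝ) + (k + 1) = p := by
    have : p - 1 - k + (k + 1) = p := by omega
    exact_mod_cast this
  push_cast
  linarith

lemma prod_Ico_succ_sub (i a : ℕ) :
    ∏ j ∈ Finset.Ico (i + 1) a, ((j : ℝ) - i) = (a - (i + 1)).factorial := by
  rw [Finset.prod_Ico_eq_prod_range, ← Finset.prod_range_add_one_eq_factorial, Nat.cast_prod]
  refine Finset.prod_congr rfl fun k _ => ?_
  push_cast
  ring

lemma prod_Ico_erase_sub {d a i : ℕ} (hi : i ∈ Finset.Ico d a) :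
    ∏ j ∈ (Finset.Ico d a).erase i, ((j : ℝ) - i) =
      (-1) ^ (i - d) * ((i - d).factorial * (a - (i + 1)).factorial) := by
  obtain ⟨h1, h2⟩ := Finset.mem_Ico.1 hi
  have h : (Finset.Ico d a).erase i = Finset.Ico d i ∪ Finset.Ico (i + 1) a := by
    ext j
    simp only [Finset.mem_erase, Finset.mem_Ico, Finset.mem_union]
    omega
  rw [h, Finset.prod_union, prod_Ico_sub_right d i h1, prod_Ico_succ_sub, mul_assoc]
  rw [Finset.disjoint_left]
  intro j hj hj'
  simp only [Finset.mem_Ico] at hj hj'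
  omega

lemma prod_Ico_add_eq_div {d a : ℕ} (hd : 0 < d) (h : d ≤ a) (l : ℕ) :
    ∏ k ∈ Finset.Ico d a, ((l : ℝ) + k) =
      ((l + a - 1).factorial : ℝ) / (l + d - 1).factorial := by
  induction a, h using Nat.le_induction with
  | base =>
    rw [Finset.Ico_self, Finset.prod_empty, div_self (by positivity)]
  | succ a ha ih =>
    rw [Finset.prod_Ico_succ_top ha, ih, show l + (a + 1) - 1 = (l + a - 1) + 1 by omega,
      Nat.factorial_succ, show l + a - 1 + 1 = l + a by omega]
    push_cast
    ring

lemma integral_pow_mul_one_sub_pow (p N : ℕ) :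
    ∫ s in (0 : ℝ)..1, s ^ p * (1 - s) ^ N =
      (p.factorial : ℝ) * N.factorial / (p + N + 1).factorial := by
  have h := Complex.betaIntegral_eval_nat_add_one_right (u := (p : ℂ) + 1)
    (by simp; positivity) N
  have h1 : Complex.betaIntegral ((p : ℂ) + 1) (N + 1) =
      ((∫ s in (0 : ℝ)..1, s ^ p * (1 - s) ^ N : ℝ) : ℂ) := by
    rw [Complex.betaIntegral, ← intervalIntegral.integral_ofReal]
    refine intervalIntegral.integral_congr fun s _ => ?_
    simp
  have h2 : ∀ N : ℕ, ((∏ j ∈ Finset.range (N + 1), ((p : ℝ) + 1 + j)) * p.factorial : ℝ) =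
      (p + N + 1).factorial := by
    intro N
    induction N with
    | zero => simp [Nat.factorial_succ]
    | succ N ih =>
      rw [Finset.prod_range_succ, mul_right_comm, ih, ← add_assoc p N 1,
        Nat.factorial_succ (p + N + 1)]
      push_cast
      ring
  rw [h1] at h
  have h3 : (∫ s in (0 : ℝ)..1, s ^ p * (1 - s) ^ N) =
      N.factorial / ∏ j ∈ Finset.range (N + 1), ((p : ℝ) + 1 + j) := by
    refine Complex.ofReal_injective (h.trans ?_)
    push_cast
    rfl
  have h4 : 0 < ∏ j ∈ Finset.range (N + 1), ((p : ℝ) + 1 + j) :=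
    Finset.prod_pos fun j _ => by positivity
  rw [h3, ← h2 N]
  field_simp

namespace TreeProduct

/-- The denominators are `(-1)^(i - d) (i - d)! (a - 1 - i)!`, so up to the factor `1 / (a - d -
1)!` the coefficients are signed binomial coefficients, and the sum is the expansion of `(1 - s)^(a
- d - 1)`. Nonnegativity and the moments are read off from this closed form. -/
lemma radialWeight_eq {d a : ℕ} (hd : 0 < d) (h : d < a) (l : ℕ) (s : ℝ) :
    radialWeight d a l s = (l + a - 1).factorial / (l + d - 1).factorial *
      (s ^ (l + d - 1) * (1 - s) ^ (a - d - 1) / (a - d - 1).factorial) := by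
  rw [radialWeight, prod_Ico_add_eq_div hd h.le]
  congr 1
  obtain ⟨N, rfl⟩ := Nat.exists_eq_add_of_lt h
  have h1 : d + N + 1 - d - 1 = N := by omega
  -- Writing `1 - s` as `-s + 1` makes the summation index of `add_pow` the exponent of `-s`,
  -- matching `i = d + m`.
  rw [h1, Finset.sum_congr rfl fun i hi => by rw [prod_Ico_erase_sub hi],
    Finset.sum_Ico_eq_sum_range, show d + N + 1 - d = N + 1 by omega,
    show (1 - s) = -s + 1 by ring, add_pow, Finset.mul_sum, Finset.sum_div]
  refine Finset.sum_congr rfl fun m hm => ?_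
  have hm' : m ≤ N := Nat.lt_succ_iff.1 (Finset.mem_range.1 hm)
  rw [Nat.cast_choose ℝ hm', Nat.add_sub_cancel_left, show d + N + 1 - (d + m + 1) = N - m by omega,
    show d + m + l - 1 = (l + d - 1) + m by omega, pow_add, neg_pow s, one_pow]
  have h3 : ((-1 : ℝ) ^ m) * (-1) ^ m = 1 := by rw [← mul_pow]; simp
  have h4 : (-1 : ℝ) ^ m ≠ 0 := pow_ne_zero _ (by norm_num)
  field_simp
  rw [pow_two, h3, mul_one]

lemma radialWeight_nonneg {d a : ℕ} (hd : 0 < d) (h : d < a) (l : ℕ) {s : ℝ}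
    (hs : s ∈ Icc (0 : ℝ) 1) : 0 ≤ radialWeight d a l s := by
  rw [radialWeight_eq hd h]
  have h1 := hs.1
  have h2 : 0 ≤ 1 - s := sub_nonneg.2 hs.2
  positivity

lemma continuous_radialWeight (d a l : ℕ) : Continuous (radialWeight d a l) := by
  unfold radialWeight
  fun_prop

/-- The measure with density `radialWeight d a l` on `[0, 1]` if `d < a`, and the unit point mass
at `1` otherwise. -/
def radialMeasure (d a l : ℕ) : Measure ℝ :=
  if d < a then (volume.restrict (Icc (0 : ℝ) 1)).withDensity fun s =>
    ENNReal.ofReal (radialWeight d a l s)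
  else Measure.dirac 1

instance isFiniteMeasure_radialMeasure (d a l : ℕ) : IsFiniteMeasure (radialMeasure d a l) := by
  unfold radialMeasure
  split_ifs
  · refine isFiniteMeasure_withDensity_ofReal (Integrable.hasFiniteIntegral ?_)
    exact (continuous_radialWeight d a l).integrableOn_Icc
  · infer_instance

lemma radialMeasure_compl_Icc (d a l : ℕ) : radialMeasure d a l (Icc 0 1)ᶜ = 0 := by
  unfold radialMeasure
  split_ifs
  · refine withDensity_absolutelyContinuous _ _ ?_
    rw [Measure.restrict_apply measurableSet_Icc.compl, compl_inter_self, measure_empty]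
  · simp

lemma integrable_pow_radialMeasure (d a l n : ℕ) :
    Integrable (fun s : ℝ => s ^ n) (radialMeasure d a l) := by
  refine Integrable.of_bound (by fun_prop) 1 ?_
  have h : ∀ᵐ s ∂radialMeasure d a l, s ∈ Icc (0 : ℝ) 1 := radialMeasure_compl_Icc d a l
  filter_upwards [h] with s hs
  rw [norm_pow, Real.norm_of_nonneg hs.1]
  exact pow_le_one₀ hs.1 hs.2

/-- For `d < a` this is a Beta integral; for `a = d` the factorials cancel and both sides are `1`.
-/
lemma integral_pow_radialMeasure {d a : ℕ} (hd : 0 < d) (h : d ≤ a) (l n : ℕ) :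
    ∫ s, s ^ n ∂radialMeasure d a l =
      ((l + a - 1).factorial : ℝ) / (l + d - 1).factorial *
        ((l + n + d - 1).factorial / (l + n + a - 1).factorial) := by
  unfold radialMeasure
  split_ifs with h'
  · simp only [ENNReal.ofReal]
    rw [integral_withDensity_eq_integral_smul
      (continuous_radialWeight d a l).measurable.real_toNNReal]
    have h1 : ∀ s ∈ Icc (0 : ℝ) 1, (radialWeight d a l s).toNNReal • s ^ n =
        (l + a - 1).factorial / (l + d - 1).factorial / (a - d - 1).factorial *
          (s ^ (l + n + d - 1) * (1 - s) ^ (a - d - 1)) := by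
      intro s hs
      rw [NNReal.smul_def, Real.coe_toNNReal _ (radialWeight_nonneg hd h' l hs),
        radialWeight_eq hd h', smul_eq_mul, show l + n + d - 1 = l + d - 1 + n by omega, pow_add]
      ring
    rw [setIntegral_congr_fun measurableSet_Icc h1, integral_Icc_eq_integral_Ioc,
      ← intervalIntegral.integral_of_le zero_le_one, intervalIntegral.integral_const_mul,
      integral_pow_mul_one_sub_pow,
      show l + n + d - 1 + (a - d - 1) + 1 = l + n + a - 1 by omega]
    field_simp
  · obtain rfl : a = d := by omega
    simp only [integral_dirac, one_pow]
    field_simp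

end TreeProduct

namespace TreeProduct

variable {d : ℕ}

/-! ### The weighted surface measures -/

/-- The measure `|z^δ|² / ‖z^δ‖² dσ` on the unit sphere. -/
def monomMeasure (δ : Fin d → ℕ) : Measure (Sphere d) :=
  (sphereMeasure d).withDensity fun z =>
    ENNReal.ofReal (‖monom z.1 δ‖ ^ 2 / ∫ ζ, ‖monom ζ.1 δ‖ ^ 2 ∂sphereMeasure d)

lemma continuous_norm_monom_sq (α : Fin d → ℕ) :
    Continuous fun z : Sphere d => ‖monom z.1 α‖ ^ 2 :=
  ((continuous_monom α).comp continuous_subtype_val).norm.pow 2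

instance isFiniteMeasure_monomMeasure [NeZero d] (δ : Fin d → ℕ) :
    IsFiniteMeasure (monomMeasure δ) :=
  isFiniteMeasure_withDensity_ofReal
    (((continuous_norm_monom_sq δ).div_const _).integrable_of_hasCompactSupport
      (HasCompactSupport.of_compactSpace _)).hasFiniteIntegral

lemma isProbabilityMeasure_monomMeasure_zero [NeZero d] :
    IsProbabilityMeasure (monomMeasure (0 : Fin d → ℕ)) := by
  simp only [monomMeasure, monom_zero, norm_one, one_pow, integral_const, probReal_univ,
    smul_eq_mul, mul_one, div_one, ENNReal.ofReal_one, withDensity_const, one_smul]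
  infer_instance

lemma integrable_norm_monom_sq [NeZero d] (δ α : Fin d → ℕ) :
    Integrable (fun z : Sphere d => ‖monom z.1 α‖ ^ 2) (monomMeasure δ) :=
  (continuous_norm_monom_sq α).integrable_of_hasCompactSupport (HasCompactSupport.of_compactSpace _)

lemma integral_norm_monom_sq_monomMeasure [NeZero d] (δ α : Fin d → ℕ) :
    ∫ z, ‖monom z.1 α‖ ^ 2 ∂monomMeasure δ =
      (∫ ζ, ‖monom ζ.1 (δ + α)‖ ^ 2 ∂sphereMeasure d) /
        ∫ ζ, ‖monom ζ.1 δ‖ ^ 2 ∂sphereMeasure d := by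
  simp only [monomMeasure, ENNReal.ofReal]
  rw [integral_withDensity_eq_integral_smul
    ((continuous_norm_monom_sq δ).div_const _).measurable.real_toNNReal, ← integral_div]
  refine integral_congr_ae (.of_forall fun z => ?_)
  simp only [NNReal.smul_def, smul_eq_mul]
  rw [Real.coe_toNNReal _ (div_nonneg (by positivity) (integral_nonneg fun _ => by positivity)),
    monom_add, norm_mul]
  ring

/-! ### The representing measure -/

/-- The scalar product measure belonging to the vertices of depth `δ`. -/
def depthMeasure (a : ℕ) (δ : Fin d → ℕ) : Measure (ℝ × Sphere d) :=
  (radialMeasure d a (∑ j, δ j)).prod (monomMeasure δ)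

instance isFiniteMeasure_depthMeasure [NeZero d] (a : ℕ) (δ : Fin d → ℕ) :
    IsFiniteMeasure (depthMeasure a δ) := by
  unfold depthMeasure
  infer_instance

lemma integrable_depthMeasure [NeZero d] (a : ℕ) (δ α : Fin d → ℕ) :
    Integrable (fun p : ℝ × Sphere d => p.1 ^ (∑ j, α j) * ‖monom p.2.1 α‖ ^ 2)
      (depthMeasure a δ) :=
  (integrable_pow_radialMeasure d a _ _).mul_prod (integrable_norm_monom_sq δ α)

/-- The factorials `(|δ| + d - 1)!` and `(|δ| + |α| + d - 1)!` of the spherical moments cancel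
against those of the radial moment, leaving the same ratio with `a` in place of `d`. -/
lemma integral_depthMeasure [NeZero d] {a : ℕ} (h : d ≤ a) (δ α : Fin d → ℕ) :
    ∫ p : ℝ × Sphere d, p.1 ^ (∑ j, α j) * ‖monom p.2.1 α‖ ^ 2 ∂depthMeasure a δ =
      druryArvesonMoment a (δ + α) / druryArvesonMoment a δ := by
  have hs : ∑ j, (δ + α) j = (∑ j, δ j) + ∑ j, α j := by simp [Finset.sum_add_distrib]
  have hpos : ∀ β : Fin d → ℕ, (∏ j, ((β j).factorial : ℝ)) ≠ 0 := fun β =>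
    Finset.prod_ne_zero_iff.2 fun j _ => by positivity
  rw [depthMeasure, integral_prod_mul (fun s : ℝ => s ^ (∑ j, α j))
    fun z : Sphere d => ‖monom z.1 α‖ ^ 2, integral_pow_radialMeasure (NeZero.pos d) h,
    integral_norm_monom_sq_monomMeasure, integral_sphereMeasure_norm_monom_sq,
    integral_sphereMeasure_norm_monom_sq, druryArvesonMoment, druryArvesonMoment, hs]
  have h1 := hpos δ
  have h2 := hpos (δ + α)
  field_simp

lemma depthMeasure_eq_zero [NeZero d] (a : ℕ) (δ : Fin d → ℕ) {A : Set (ℝ × Sphere d)}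
    (hA : Disjoint A (Icc 0 1 ×ˢ univ)) : depthMeasure a δ A = 0 := by
  refine measure_mono_null (t := (Icc (0 : ℝ) 1)ᶜ ×ˢ univ) ?_ ?_
  · intro p hp
    refine ⟨fun h => ?_, mem_univ _⟩
    exact Set.disjoint_left.1 hA hp ⟨h, mem_univ _⟩
  · rw [depthMeasure, Measure.prod_prod, radialMeasure_compl_Icc, zero_mul]

lemma isProbabilityMeasure_radialMeasure_zero {a : ℕ} (hd : 0 < d) (h : d ≤ a) :
    IsProbabilityMeasure (radialMeasure d a 0) := by
  have h1 := integral_pow_radialMeasure hd h 0 0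
  have h2 : (((0 + a - 1).factorial : ℝ) / (0 + d - 1).factorial *
      ((0 + 0 + d - 1).factorial / (0 + 0 + a - 1).factorial)) = 1 := by
    simp only [zero_add]
    field_simp
  rw [h2] at h1
  simp only [pow_zero, integral_const, smul_eq_mul, mul_one] at h1
  exact ⟨by rwa [measureReal_def, ENNReal.toReal_eq_one_iff] at h1⟩

variable {V : Fin d → Type*} {T : ∀ j, RootedDirectedTree (V j)}

/-- The operator valued measure `A ↦ ∑ i ∈ s, m_i(A) Q_i`, for scalar measures `m_i` and operators
`Q_i`. -/
def sumOperatorMeasure {X ι H : Type*} [MeasurableSpace X] [NormedAddCommGroup H]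
    [NormedSpace ℂ H] (s : Finset ι) (m : ι → Measure X) [∀ i, IsFiniteMeasure (m i)]
    (Q : ι → H →L[ℂ] H) : VectorMeasure X (H →L[ℂ] H) :=
  ∑ i ∈ s, (m i).toSignedMeasure.mapRange
    { toFun := fun r => (r : ℂ) • Q i
      map_zero' := by simp
      map_add' := fun r t => by simp [add_smul] }
    (by
      change Continuous fun r : ℝ => (r : ℂ) • Q i
      fun_prop)

lemma sumOperatorMeasure_apply {X ι H : Type*} [MeasurableSpace X] [NormedAddCommGroup H]
    [NormedSpace ℂ H] (s : Finset ι) (m : ι → Measure X) [∀ i, IsFiniteMeasure (m i)]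
    (Q : ι → H →L[ℂ] H) {A : Set X} (hA : MeasurableSet A) (f : H) :
    sumOperatorMeasure s m Q A f = ∑ i ∈ s, (((m i).real A : ℝ) : ℂ) • Q i f := by
  classical
  rw [sumOperatorMeasure]
  induction s using Finset.induction_on with
  | empty => rfl
  | insert i s hi ih =>
    rw [Finset.sum_insert hi, Finset.sum_insert hi, ← ih, add_apply, add_apply,
      VectorMeasure.mapRange_apply, Measure.toSignedMeasure_apply_measurable hA]
    rfl

lemma SupportedAt.of_mem_cokerPiece {c : AdmissibleSeq} {F : Finset (Fin d)} {u : ∀ j, V j}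
    (hu : u ∈ Phi T F) {f : ℓ²(∀ j, V j, ℂ)} (hf : f ∈ cokerPiece T c u F) :
    SupportedAt T f (depth T u) := fun v hv =>
  hf.1 v fun h => hv (depth_of_mem_sib T hu h)

/-- The scalar measures depend on `u` only through `d_u`, and each `L_{u,F}` lies at depth `d_u`. So
`M` can be built from the depth projections, without first decomposing `E` into the spaces
`L_{u,F}`. -/
lemma isRepresentingMeasure_sumOperatorMeasure (hfin : ∀ j v, ((T j).children v).Finite)
    (hleaf : ∀ j, (T j).Leafless) [NeZero d] (hd : 0 < d) {a : ℕ} (ha : 0 < a) (had : d ≤ a)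
    {N : Fin d → ℕ}
    (hN : ∀ f ∈ jointKernel T (druryArvesonSeq d a hd (Nat.cast_pos.2 ha)), ∀ v, f v ≠ 0 →
      depth T v ≤ N) {Ω : Finset (Fin d) → Set (∀ j, V j)} (hΩ : IsIndexing T Ω) :
    IsRepresentingMeasure T (druryArvesonSeq d a hd (Nat.cast_pos.2 ha)) 1 1 Ω
      (sumOperatorMeasure (Finset.Iic N) (depthMeasure a) (kernelProj hfin hleaf _))
      (fun u => radialMeasure d a (absDepth T u)) (fun u => monomMeasure (depth T u)) where
  finite F u _ := ⟨inferInstance, inferInstance⟩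
  supported_scalar F u _ := radialMeasure_compl_Icc _ _ _
  supported A hA hdisj := by
    refine ContinuousLinearMap.ext fun f => ?_
    rw [sumOperatorMeasure_apply _ _ _ hA]
    refine Finset.sum_eq_zero fun δ _ => ?_
    rw [measureReal_def, depthMeasure_eq_zero a δ hdisj]
    simp
  integral_representation f := by
    -- The weight of `m_δ` is `⟨f, P_δ f⟩ = ‖P_δ f‖²`, as `P_δ` is an orthogonal projection.
    refine ⟨∑ δ ∈ Finset.Iic N, ‖kernelProj hfin hleaf _ δ f‖₊ ^ 2 • depthMeasure a δ,
      inferInstance, fun A hA => ?_, fun α => ⟨?_, ?_⟩⟩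
    · rw [sumOperatorMeasure_apply _ _ _ hA, inner_sum, measureReal_def,
        Measure.finsetSum_apply, ENNReal.toReal_sum (fun δ _ => measure_ne_top _ _),
        Complex.ofReal_sum]
      refine Finset.sum_congr rfl fun δ _ => ?_
      refine (inner_smul_right f (kernelProj hfin hleaf _ δ f)
        (((depthMeasure a δ).real A : ℝ) : ℂ)).trans ?_
      rw [inner_kernelProj, mul_comm, ← measureReal_def,
        measureReal_nnreal_smul_apply]
      push_cast
      rfl
    · exact integrable_finsetSum_measure.2 fun δ _ =>
        (integrable_depthMeasure a δ α).smul_measure_nnreal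
    · rw [modelNorm_monomial_sq, norm_shiftPow_sq hfin hleaf _
        (raisesDepth_shiftPow hfin hleaf hd ha α) hN, integral_finsetSum_measure fun δ _ =>
          (integrable_depthMeasure a δ α).smul_measure_nnreal]
      refine Finset.sum_congr rfl fun δ _ => ?_
      rw [integral_smul_nnreal_measure, integral_depthMeasure had]
      rfl
  diagonal A hA I hI g hg := by
    rw [map_sum]
    refine Finset.sum_congr rfl fun p hp => ?_
    have hsupp := SupportedAt.of_mem_cokerPiece ((hΩ p.1).1 (hI p hp)) (hg p hp)
    rw [sumOperatorMeasure_apply _ _ _ hA]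
    have hproj : ∀ δ, kernelProj hfin hleaf _ δ (g p) =
        if depth T p.2 = δ then g p else 0 := by
      intro δ
      refine Subtype.ext ((hsupp.depthProj_eq δ).trans ?_)
      split_ifs <;> rfl
    simp only [hproj, smul_ite, smul_zero, Finset.sum_ite_eq, Finset.mem_Iic]
    split_ifs with h
    · rfl
    · have h0 : g p = 0 := by
        refine Subtype.ext (lp.ext (funext fun v => ?_))
        by_contra hv
        by_cases hv' : depth T v = depth T p.2
        · exact h (Finset.mem_Iic.2 (hv' ▸ hN _ (g p).2 v hv))
        · exact hv (hsupp v hv')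
      rw [h0, smul_zero]
  normalized := by
    have h0 : absDepth T (root T) = 0 := by simp [absDepth, depth_root]
    rw [h0, depth_root]
    exact ⟨isProbabilityMeasure_radialMeasure_zero hd had, isProbabilityMeasure_monomMeasure_zero⟩

end TreeProduct

end

theorem corollary2p10 {d : ℕ} (hd : 0 < d) {V : Fin d → Type*}
    (T : ∀ j, RootedDirectedTree (V j))
    (hfin : ∀ j, (T j).LocallyFinite) (hleaf : ∀ j, (T j).Leafless)
    (hbranch : ∀ j, (T j).branchingIndex ≠ ⊤)
    (a : ℕ) (ha : 0 < a) (had : d ≤ a)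
    (Ω : Finset (Fin d) → Set (∀ j, V j)) (hΩ : TreeProduct.IsIndexing T Ω) :
    (d < a → ∀ l : ℕ, ∀ s ∈ Set.Icc (0 : ℝ) 1, 0 ≤ TreeProduct.radialWeight d a l s) ∧
    ∃ (M : VectorMeasure (ℝ × TreeProduct.Sphere d)
          (TreeProduct.jointKernel T (druryArvesonSeq d a hd (Nat.cast_pos.2 ha)) →L[ℂ]
            TreeProduct.jointKernel T (druryArvesonSeq d a hd (Nat.cast_pos.2 ha))))
      (ρ : (∀ j, V j) → Measure ℝ) (ν : (∀ j, V j) → Measure (TreeProduct.Sphere d)),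
      TreeProduct.IsRepresentingMeasure T (druryArvesonSeq d a hd (Nat.cast_pos.2 ha)) 1 1 Ω M ρ ν ∧
      ∀ F, ∀ u ∈ Ω F,
        (d < a → ρ u = (volume.restrict (Set.Icc (0 : ℝ) 1)).withDensity fun s =>
          ENNReal.ofReal (TreeProduct.radialWeight d a (TreeProduct.absDepth T u) s)) ∧
        (a = d → ρ u = Measure.dirac 1) ∧
        ν u = (TreeProduct.sphereMeasure d).withDensity fun z =>
          ENNReal.ofReal (‖TreeProduct.monom z.1 (TreeProduct.depth T u)‖ ^ 2 /
            ∫ ζ, ‖TreeProduct.monom ζ.1 (TreeProduct.depth T u)‖ ^ 2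
              ∂TreeProduct.sphereMeasure d) := by
  have : NeZero d := ⟨hd.ne'⟩
  obtain ⟨N, hN⟩ := TreeProduct.exists_depth_bound hfin hleaf hbranch
    (druryArvesonSeq d a hd (Nat.cast_pos.2 ha))
  refine ⟨fun h l s hs => TreeProduct.radialWeight_nonneg hd h l hs, _, _, _,
    TreeProduct.isRepresentingMeasure_sumOperatorMeasure hfin hleaf hd ha had hN hΩ,
    fun F u _ => ⟨fun h => ?_, fun h => ?_, rfl⟩⟩
  · simp only [TreeProduct.radialMeasure, if_pos h]
  · simp only [TreeProduct.radialMeasure, if_neg h.le.not_gt]
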